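/- **Setting.** Let $\Sigma$ be the infinite honeycomb lattice in brick-wall form: vertex set $V=\mathbb Z^2\subset\mathbb R^2$, all horizontal unit edges, and vertical edges $(x,y)-(x,y+1)$ with $x+y$ odd. Its faces (each with six vertices) are properly colored red, green, blue ($\mathtt r,\mathtt g,\mathtt b$); an edge has color $c$ if it connects two faces of color $c$. A qubit sits at each vertex; $\mathcal A(\Lambda)$ is the norm closure of the algebra of local observables supported in $\Lambda\subseteq V$, and $\mathcal A=\mathcal A(V)$ is the quasi-local $C^*$-algebra. For a face $f$ put $K_f=\bigotimes_{v\in\partial f}\sigma^{\mathtt x}_v$ and $J_f=\bigotimes_{v\in\partial f}\sigma^{\mathtt z}_v$. For $A$ localized in a finite set $\Lambda$ let $\delta(A)=i[H,A]$ with $H=-\sum_{f:\,\partial f\cap\Lambda\ne\emptyset}(K_f+J_f)$. A state $\omega$ on $\mathcal A$ is a ground state if $-i\,\omega(A^*\delta(A))\ge 0$ for all local $A$. A half-infinite string $\gamma$ of color $c$ is a sequence $(f_0,v_0,v_1,f_1,v_2,v_3,f_2,\dots)$ without repeated vertices, in which all faces $f_i$ have color $c$, $f_i\neq f_{i+1}$,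 $v_{2i}\in\partial f_i$, $v_{2i+1}\in\partial f_{i+1}$, and $v_{2i},v_{2i+1}$ are joined by an edge. Let $\gamma_n$ be its initial segments, $S^{c\mathtt x}_{\gamma_n}=\bigotimes_{v_j\in\gamma_n}\sigma^{\mathtt x}_{v_j}$, $S^{c\mathtt z}_{\gamma_n}=\bigotimes_{v_j\in\gamma_n}\sigma^{\mathtt z}_{v_j}$, $S^{c\mathtt y}_{\gamma_n}=S^{c\mathtt x}_{\gamma_n}S^{c\mathtt z}_{\gamma_n}$, and for $k\in\{\mathtt x,\mathtt y,\mathtt z\}$ let $\rho^{ck}_\gamma(A)=\lim_{n}(S^{ck}_{\gamma_n})^*AS^{ck}_{\gamma_n}$ for $A\in\mathcal A$. A cone is the set of vertices in $\{x\in\mathbb R^2:(x-p)\cdot a>\|x-p\|\cos\theta\}$ with $p\in\mathbb R^2$, $\|a\|=1$, $0<\theta<\pi$. **Theorem.** There is a unique ground state $\omega_0$ of the color code on $\Sigma$ that is invariant under all translations mapping $\Sigma$ to itself; let $\pi_0$ be its GNS representation. Denote by $\pi^{ck}$ the GNS representation of $\omega_0\circ\rho^{ck}_{\gamma}$, and by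 $\pi^{ck,c'k'}$ the GNS representation of $\omega_0\circ\rho^{ck}_{\gamma}\circ\rho^{c'k'}_{\gamma'}$, where $\gamma$ and $\gamma'$ are half-infinite strings of colors $c$ and $c'$; all statements below hold for arbitrary choices of the strings, and $\simeq$ is unitary equivalence. 1. For all colors $c\neq c'$ and labels $k\neq k'$, the representation $\pi^{ck,c'k'}$ is a superselection sector, i.e. $\pi^{ck,c'k'}|_{\mathcal A(\Lambda^c)}\simeq\pi_0|_{\mathcal A(\Lambda^c)}$ for every cone $\Lambda$ with complement $\Lambda^c=V\setminus\Lambda$; it is not equivalent to $\pi_0$, nor to any $\pi^{c''k''}$ with $c''\in\{\mathtt r,\mathtt g,\mathtt b\}$, $k''\in\{\mathtt x,\mathtt y,\mathtt z\}$. 2. The following equivalences hold, defining the six sectors $\pi^{\mathtt f_1},\dots,\pi^{\mathtt f_6}$: $$\begin{aligned} \pi^{\mathtt f_1}:&\quad \pi^{\mathtt{rx},\mathtt{bz}}\simeq\pi^{\mathtt{ry},\mathtt{gz}}\simeq\pi^{\mathtt{gx},\mathtt{by}},& \pi^{\mathtt f_2}:&\quad \pi^{\mathtt{rz},\mathtt{bx}}\simeq\pi^{\mathtt{ry},\mathtt{gx}}\simeq\pi^{\mathtt{gz},\mathtt{by}},\\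 \pi^{\mathtt f_3}:&\quad \pi^{\mathtt{bz},\mathtt{gy}}\simeq\pi^{\mathtt{gx},\mathtt{rz}}\simeq\pi^{\mathtt{bx},\mathtt{ry}},& \pi^{\mathtt f_4}:&\quad \pi^{\mathtt{rz},\mathtt{gy}}\simeq\pi^{\mathtt{gx},\mathtt{bz}}\simeq\pi^{\mathtt{rx},\mathtt{by}},\\ \pi^{\mathtt f_5}:&\quad \pi^{\mathtt{rx},\mathtt{gy}}\simeq\pi^{\mathtt{bx},\mathtt{gz}}\simeq\pi^{\mathtt{by},\mathtt{rz}},& \pi^{\mathtt f_6}:&\quad \pi^{\mathtt{bx},\mathtt{gy}}\simeq\pi^{\mathtt{rx},\mathtt{gz}}\simeq\pi^{\mathtt{ry},\mathtt{bz}}. \end{aligned}$$ 3. Representations belonging to different $\mathtt f_i$ are not equivalent. -/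

import Mathlib

open scoped ComplexOrder ComplexConjugate

noncomputable section

namespace ColorCode

/-! ### The lattice

The trivalent lattice `Σ` is drawn with rectangular faces (the brick-wall form of the honeycomb
lattice): its vertices are the points of `ℤ × ℤ`, all horizontal unit edges are present, and the
vertical edge from `(x, y)` to `(x, y + 1)` is present exactly when `x + y` is odd. -/

abbrev Vertex : Type := ℤ × ℤ

/-- The lattice `Σ` as a graph. -/
def lattice : SimpleGraph Vertex :=
  SimpleGraph.fromRel fun v w =>
    w = (v.1 + 1, v.2) ∨ (Odd (v.1 + v.2) ∧ w = (v.1, v.2 + 1))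

/-- A face (brick) is given by its lower left corner, a point `(x, y)` with `x + y` odd. -/
abbrev Face : Type := {p : ℤ × ℤ // Odd (p.1 + p.2)}

/-- The six vertices of a brick, relative to its lower left corner. -/
def brick : List (ℤ × ℤ) := [(0, 0), (1, 0), (2, 0), (0, 1), (1, 1), (2, 1)]

/-- The six vertices `v ∈ ∂f` of a face. -/
def Face.boundary (f : Face) : List Vertex := brick.map fun d => f.1 + d

/-- The three colors: red, green, blue. -/
inductive Color
  | r | g | b
  deriving DecidableEq

/-- The three kinds of Pauli operators. -/
inductive Pauli
  | x | y | z
  deriving DecidableEq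

/-- The face coloring (unique up to a permutation of the colors). -/
def Face.color (f : Face) : Color :=
  if f.1.1 % 3 = 0 then .r else if f.1.1 % 3 = 1 then .g else .b

/-- The faces having at least one vertex in the finite set `Λ`. -/
def facesMeeting (Λ : Finset Vertex) : Finset Face :=
  (Λ.biUnion fun v => (brick.map fun d => v - d).toFinset).subtype fun p => Odd (p.1 + p.2)

theorem mem_facesMeeting {Λ : Finset Vertex} {f : Face} :
    f ∈ facesMeeting Λ ↔ ∃ v ∈ f.boundary, v ∈ Λ := by
  simp only [facesMeeting, Face.boundary, Finset.mem_subtype, Finset.mem_biUnion,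
    List.mem_toFinset, List.mem_map]
  constructor
  · rintro ⟨v, hv, d, hd, h⟩
    exact ⟨v, ⟨d, hd, by rw [← h]; abel⟩, hv⟩
  · rintro ⟨v, ⟨d, hd, h⟩, hv⟩
    exact ⟨v, hv, d, hd, by rw [← h]; abel⟩

/-! ### The quasi-local algebra

The algebra of local observables is represented faithfully on the Hilbert space with orthonormal
basis `|s⟩`, `s` a finite set of vertices: `|s⟩` is the product vector with the qubits at the
vertices of `s` in the state `|1⟩` and all other qubits in the state `|0⟩`.  The algebra
`A(Λ) = ⨂_{v ∈ Λ} M₂(ℂ)` of a finite set `Λ` acts on the tensor factors of the vertices in `Λ`.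
The quasi-local algebra is the norm closure of the union of these algebras. -/

abbrev ConfigSpace : Type := lp (fun _ : Finset Vertex => ℂ) 2

/-- The bounded operator `(T ψ)(s) = g s * ψ (σ s)`, for a permutation `σ` of the configurations
and a bounded weight `g`. -/
def weightedPerm (σ : Equiv.Perm (Finset Vertex)) (g : Finset Vertex → ℂ)
    (hg : ∃ C : ℝ, ∀ s, ‖g s‖ ≤ C) : ConfigSpace →L[ℂ] ConfigSpace :=
  have key : ∀ (C : ℝ), (∀ s, ‖g s‖ ≤ C) → ∀ (ψ : ConfigSpace) (F : Finset (Finset Vertex)),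
      ∑ s ∈ F, ‖g s * ψ (σ s)‖ ^ (2 : ENNReal).toReal ≤
        (C * ‖ψ‖) ^ (2 : ENNReal).toReal := by
    intro C hC ψ F
    have hC0 : 0 ≤ C := (norm_nonneg _).trans (hC ∅)
    have h2 : (0 : ℝ) < (2 : ENNReal).toReal := by norm_num
    calc ∑ s ∈ F, ‖g s * ψ (σ s)‖ ^ (2 : ENNReal).toReal
        ≤ ∑ s ∈ F, C ^ (2 : ENNReal).toReal * ‖ψ (σ s)‖ ^ (2 : ENNReal).toReal := by
          refine Finset.sum_le_sum fun s _ => ?_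
          rw [← Real.mul_rpow hC0 (norm_nonneg _), norm_mul]
          have := hC s
          gcongr
      _ = C ^ (2 : ENNReal).toReal *
            ∑ t ∈ F.map σ.toEmbedding, ‖ψ t‖ ^ (2 : ENNReal).toReal := by
          rw [Finset.sum_map, Finset.mul_sum]; rfl
      _ ≤ C ^ (2 : ENNReal).toReal * ‖ψ‖ ^ (2 : ENNReal).toReal := by
          gcongr
          exact lp.sum_rpow_le_norm_rpow h2 ψ _
      _ = (C * ‖ψ‖) ^ (2 : ENNReal).toReal := (Real.mul_rpow hC0 (norm_nonneg _)).symm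
  LinearMap.mkContinuous
    { toFun := fun ψ =>
        ⟨fun s => g s * ψ (σ s), memℓp_gen' (key hg.choose hg.choose_spec ψ)⟩
      map_add' := fun ψ φ => by
        ext s; exact mul_add _ _ _
      map_smul' := fun c ψ => by
        ext s; simp [mul_left_comm] }
    hg.choose
    (fun ψ => lp.norm_le_of_forall_sum_le (by norm_num)
      (mul_nonneg ((norm_nonneg _).trans (hg.choose_spec ∅)) (norm_nonneg _))
      (key hg.choose hg.choose_spec ψ))

@[simp] theorem weightedPerm_apply (σ g hg) (ψ : ConfigSpace) (s : Finset Vertex) :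
    weightedPerm σ g hg ψ s = g s * ψ (σ s) := rfl

theorem weightedPerm_adjoint (σ g hg hg') :
    star (weightedPerm σ g hg) =
      weightedPerm σ⁻¹ (fun s => conj (g (σ⁻¹ s))) hg' := by
  rw [ContinuousLinearMap.star_eq_adjoint]
  refine ((ContinuousLinearMap.eq_adjoint_iff _ _).2 fun x y => ?_).symm
  rw [lp.inner_eq_tsum, lp.inner_eq_tsum, ← Equiv.tsum_eq σ]
  refine tsum_congr fun s => ?_
  simp [mul_comm, mul_left_comm, mul_assoc]

/-- The state of the qubit at `v` in the configuration `s`. -/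
def spin (v : Vertex) (s : Finset Vertex) : Fin 2 := if v ∈ s then 1 else 0

/-- Flipping the qubit at `v`. -/
def flip (v : Vertex) : Equiv.Perm (Finset Vertex) :=
  Function.Involutive.toPerm (fun s => symmDiff s {v}) fun s => by simp

theorem flip_apply (v : Vertex) (s : Finset Vertex) : flip v s = symmDiff s {v} := rfl

theorem exists_bound_entry (M : Matrix (Fin 2) (Fin 2) ℂ) (i j : Finset Vertex → Fin 2) :
    ∃ C : ℝ, ∀ s, ‖M (i s) (j s)‖ ≤ C := by
  refine ⟨∑ a, ∑ b, ‖M a b‖, fun s => ?_⟩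
  refine le_trans ?_ (Finset.single_le_sum (f := fun a => ∑ b, ‖M a b‖)
    (fun a _ => Finset.sum_nonneg fun b _ => norm_nonneg _) (Finset.mem_univ (i s)))
  exact Finset.single_le_sum (f := fun b => ‖M (i s) b‖)
    (fun b _ => norm_nonneg _) (Finset.mem_univ (j s))

/-- The matrix `M` acting on the qubit at the vertex `v`. -/
def siteOp (v : Vertex) (M : Matrix (Fin 2) (Fin 2) ℂ) : ConfigSpace →L[ℂ] ConfigSpace :=
  weightedPerm 1 (fun s => M (spin v s) (spin v s)) (exists_bound_entry M _ _) +
  weightedPerm (flip v) (fun s => M (spin v s) (1 - spin v s)) (exists_bound_entry M _ _)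

theorem siteOp_apply (v : Vertex) (M : Matrix (Fin 2) (Fin 2) ℂ) (ψ : ConfigSpace)
    (s : Finset Vertex) :
    siteOp v M ψ s = M (spin v s) (spin v s) * ψ s + M (spin v s) (1 - spin v s) * ψ (flip v s) :=
  rfl

theorem spin_flip (v : Vertex) (s : Finset Vertex) : spin v (flip v s) = 1 - spin v s := by
  by_cases h : v ∈ s <;> simp [spin, flip_apply, Finset.mem_symmDiff, h]

theorem spin_flip_of_ne {v w : Vertex} (h : v ≠ w) (s : Finset Vertex) :
    spin v (flip w s) = spin v s := by
  simp [spin, flip_apply, Finset.mem_symmDiff, h]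

theorem flip_flip (v : Vertex) (s : Finset Vertex) : flip v (flip v s) = s := by
  simp [flip_apply]

theorem flip_comm (v w : Vertex) (s : Finset Vertex) :
    flip v (flip w s) = flip w (flip v s) := by
  simp only [flip_apply]
  exact symmDiff_right_comm _ _ _

theorem flip_symm (v : Vertex) : (flip v)⁻¹ = flip v := by
  rw [inv_eq_iff_mul_eq_one]
  ext1 s
  exact flip_flip v s

theorem siteOp_mul (v : Vertex) (M N : Matrix (Fin 2) (Fin 2) ℂ) :
    siteOp v (M * N) = siteOp v M * siteOp v N := by
  ext ψ s
  simp only [mul_apply_eq_comp, siteOp_apply, spin_flip, flip_flip, Matrix.mul_apply,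
    Fin.sum_univ_two]
  rcases Fin.exists_fin_two.1 ⟨spin v s, rfl⟩ with h | h <;> rw [h] <;> simp <;> ring

theorem siteOp_one (v : Vertex) : siteOp v 1 = 1 := by
  ext ψ s
  rw [siteOp_apply]
  rcases Fin.exists_fin_two.1 ⟨spin v s, rfl⟩ with h | h <;> rw [h] <;> simp

theorem siteOp_star (v : Vertex) (M : Matrix (Fin 2) (Fin 2) ℂ) :
    siteOp v (star M) = star (siteOp v M) := by
  rw [siteOp, siteOp, star_add,
    weightedPerm_adjoint 1 _ _ (exists_bound_entry (star M) _ _),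
    weightedPerm_adjoint (flip v) _ _ (by
      rw [flip_symm]; simp only [spin_flip, RCLike.norm_conj]
      exact exists_bound_entry M _ _)]
  ext ψ s
  simp only [flip_symm, spin_flip]
  rcases Fin.exists_fin_two.1 ⟨spin v s, rfl⟩ with h | h <;>
    simp [h, Matrix.star_apply]

theorem siteOp_comm {v w : Vertex} (h : v ≠ w) (M N : Matrix (Fin 2) (Fin 2) ℂ) :
    siteOp v M * siteOp w N = siteOp w N * siteOp v M := by
  ext ψ s
  simp only [mul_apply_eq_comp, siteOp_apply, spin_flip_of_ne h,
    spin_flip_of_ne h.symm, flip_comm v w]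
  ring

/-- The norm closed `*`-algebra generated by all one-qubit observables. -/
def quasiLocal : StarSubalgebra ℂ (ConfigSpace →L[ℂ] ConfigSpace) :=
  (StarAlgebra.adjoin ℂ {a | ∃ v M, siteOp v M = a}).topologicalClosure

instance : IsClosed (quasiLocal : Set (ConfigSpace →L[ℂ] ConfigSpace)) :=
  StarSubalgebra.isClosed_topologicalClosure _

/-- The quasi-local algebra `𝒜`. -/
def Obs : Type := quasiLocal

instance : CStarAlgebra Obs := inferInstanceAs (CStarAlgebra quasiLocal)
instance : PartialOrder Obs := CStarAlgebra.spectralOrder Obs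
instance : StarOrderedRing Obs := CStarAlgebra.spectralOrderedRing Obs

/-- The matrix `M` acting on the qubit at `v`, as an element of `𝒜`. -/
def site (v : Vertex) (M : Matrix (Fin 2) (Fin 2) ℂ) : Obs :=
  ⟨siteOp v M, StarSubalgebra.le_topologicalClosure _
    (StarAlgebra.subset_adjoin ℂ _ ⟨v, M, rfl⟩)⟩

/-- The algebra `A(Λ)` of observables localized in the set of vertices `Λ`. -/
def localAlg (Λ : Set Vertex) : StarSubalgebra ℂ Obs :=
  (StarAlgebra.adjoin ℂ {a | ∃ v ∈ Λ, ∃ M, site v M = a}).topologicalClosure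

/-- The inclusion of `𝒜` into the bounded operators. -/
def Obs.toOp : Obs →⋆ₐ[ℂ] (ConfigSpace →L[ℂ] ConfigSpace) := quasiLocal.subtype

theorem localAlg_univ : localAlg Set.univ = ⊤ := by
  refine top_unique fun x _ => ?_
  have hx : Obs.toOp x ∈ closure (StarAlgebra.adjoin ℂ {a | ∃ v M, siteOp v M = a} :
      Set (ConfigSpace →L[ℂ] ConfigSpace)) := x.2
  have himg : Obs.toOp '' (StarAlgebra.adjoin ℂ {a | ∃ v ∈ Set.univ, ∃ M, site v M = a} : Set Obs) =
      StarAlgebra.adjoin ℂ {a | ∃ v M, siteOp v M = a} := by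
    rw [← StarSubalgebra.coe_map, StarAlgHom.map_adjoin]
    congr 2
    ext a
    constructor
    · rintro ⟨_, ⟨v, -, M, rfl⟩, rfl⟩
      exact ⟨v, M, rfl⟩
    · rintro ⟨v, M, rfl⟩
      exact ⟨site v M, ⟨v, trivial, M, rfl⟩, rfl⟩
  rw [← himg] at hx
  exact closure_subtype.2 hx

/-- A closed property of observables that is stable under the `*`-algebra operations and holds for
the one-qubit observables holds for all of `𝒜`. -/
theorem Obs.mem_of_isClosed (S : StarSubalgebra ℂ Obs) (hS : IsClosed (S : Set Obs))
    (h : ∀ v M, site v M ∈ S) (a : Obs) : a ∈ S := by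
  have : localAlg Set.univ ≤ S := by
    refine StarSubalgebra.topologicalClosure_minimal (StarAlgebra.adjoin_le ?_) hS
    rintro _ ⟨v, -, M, rfl⟩
    exact h v M
  exact this (localAlg_univ ▸ trivial)

theorem site_mul (v : Vertex) (M N : Matrix (Fin 2) (Fin 2) ℂ) :
    site v (M * N) = site v M * site v N := Subtype.ext (siteOp_mul v M N)

theorem site_one (v : Vertex) : site v 1 = 1 := Subtype.ext (siteOp_one v)

theorem site_star (v : Vertex) (M : Matrix (Fin 2) (Fin 2) ℂ) :
    site v (star M) = star (site v M) := Subtype.ext (siteOp_star v M)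

theorem site_comm {v w : Vertex} (h : v ≠ w) (M N : Matrix (Fin 2) (Fin 2) ℂ) :
    site v M * site w N = site w N * site v M := Subtype.ext (siteOp_comm h M N)

/-! ### Stabilizers and the ground state -/

def sigmaX : Matrix (Fin 2) (Fin 2) ℂ := !![0, 1; 1, 0]

def sigmaZ : Matrix (Fin 2) (Fin 2) ℂ := !![1, 0; 0, -1]

/-- The product of the one-qubit operators `M` over the vertices in a list. -/
def siteProd (l : List Vertex) (M : Matrix (Fin 2) (Fin 2) ℂ) : Obs :=
  (l.map fun v => site v M).prod

/-- The stabilizer `K_f = ⨂_{v ∈ ∂f} σ_v^x`. -/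
def stabK (f : Face) : Obs := siteProd f.boundary sigmaX

/-- The stabilizer `J_f = ⨂_{v ∈ ∂f} σ_v^z`. -/
def stabJ (f : Face) : Obs := siteProd f.boundary sigmaZ

/-- The sum of all terms of the color code Hamiltonian that meet the finite set `Λ`. -/
def hamiltonian (Λ : Finset Vertex) : Obs :=
  -∑ f ∈ facesMeeting Λ, stabK f - ∑ f ∈ facesMeeting Λ, stabJ f

/-- The derivation `δ(A) = i [H, A]` on the observables `A` localized in the finite set `Λ`; the
terms of the Hamiltonian that do not meet `Λ` commute with `A`. -/
def derivation (Λ : Finset Vertex) (A : Obs) : Obs :=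
  Complex.I • (hamiltonian Λ * A - A * hamiltonian Λ)

/-- Linear functionals `ω` with `ω(a* a) ≥ 0` for all `a`; such an `ω` is a state if `ω 1 = 1`. -/
abbrev PosFunctional : Type := Obs →ₚ[ℂ] ℂ

/-- The action of the translation by `t` on the Hilbert space, `|s⟩ ↦ |s + t⟩`. -/
def translateOp (t : ℤ × ℤ) : ConfigSpace →L[ℂ] ConfigSpace :=
  weightedPerm (Equiv.finsetCongr (Equiv.subRight t)) (fun _ => 1) ⟨1, fun _ => by simp⟩

theorem translateOp_mem_unitary (t : ℤ × ℤ) :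
    translateOp t ∈ unitary (ConfigSpace →L[ℂ] ConfigSpace) := by
  rw [Unitary.mem_iff, translateOp, weightedPerm_adjoint _ _ _ ⟨1, fun _ => by simp⟩]
  constructor <;>
  · ext ψ s
    simp [mul_apply_eq_comp, -Equiv.finsetCongr_apply, -Equiv.finsetCongr_symm]

theorem translateOp_siteOp (t : ℤ × ℤ) (v : Vertex) (M : Matrix (Fin 2) (Fin 2) ℂ) :
    translateOp t * siteOp v M = siteOp (v + t) M * translateOp t := by
  have h1 : ∀ s, spin v (Equiv.finsetCongr (Equiv.subRight t) s) = spin (v + t) s := by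
    intro s
    simp [spin]
  have h2 : ∀ s, flip v (Equiv.finsetCongr (Equiv.subRight t) s) =
      Equiv.finsetCongr (Equiv.subRight t) (flip (v + t) s) := by
    intro s
    ext w
    simp [flip_apply, Finset.mem_symmDiff]
  ext ψ s
  simp only [mul_apply_eq_comp, translateOp, weightedPerm_apply, siteOp_apply, h1, h2, one_mul]

/-- The automorphism `a ↦ T_t a T_t*` of the bounded operators. -/
def translateConj (t : ℤ × ℤ) :
    (ConfigSpace →L[ℂ] ConfigSpace) →⋆ₐ[ℂ] (ConfigSpace →L[ℂ] ConfigSpace) :=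
  (Unitary.conjStarAlgAut ℂ _ ⟨translateOp t, translateOp_mem_unitary t⟩ :
    (ConfigSpace →L[ℂ] ConfigSpace) ≃⋆ₐ[ℂ] (ConfigSpace →L[ℂ] ConfigSpace))

theorem translateConj_apply (t : ℤ × ℤ) (a : ConfigSpace →L[ℂ] ConfigSpace) :
    translateConj t a = translateOp t * a * star (translateOp t) := rfl

theorem translateConj_siteOp (t : ℤ × ℤ) (v : Vertex) (M : Matrix (Fin 2) (Fin 2) ℂ) :
    translateConj t (siteOp v M) = siteOp (v + t) M := by
  rw [translateConj_apply, translateOp_siteOp, mul_assoc,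
    (Unitary.mem_iff.1 (translateOp_mem_unitary t)).2, mul_one]

theorem translateConj_mem (t : ℤ × ℤ) (a : Obs) :
    translateConj t (Obs.toOp a) ∈ quasiLocal := by
  have hc : Continuous (translateConj t) := by
    have : (translateConj t : (ConfigSpace →L[ℂ] ConfigSpace) → _) =
      fun a => translateOp t * a * star (translateOp t) := rfl
    rw [this]; fun_prop
  have hc' : Continuous Obs.toOp := continuous_subtype_val
  refine Obs.mem_of_isClosed (quasiLocal.comap ((translateConj t).comp Obs.toOp)) ?_ ?_ a
  · exact IsClosed.preimage (hc.comp hc') (StarSubalgebra.isClosed_topologicalClosure _)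
  · intro v M
    change translateConj t (siteOp v M) ∈ quasiLocal
    rw [translateConj_siteOp]
    exact (site (v + t) M).2

/-- The translation automorphism `τ_t` of `𝒜`. -/
def translate (t : ℤ × ℤ) : Obs →⋆ₐ[ℂ] Obs :=
  StarAlgHom.codRestrict ((translateConj t).comp Obs.toOp) quasiLocal (translateConj_mem t)

theorem translate_site (t : ℤ × ℤ) (v : Vertex) (M : Matrix (Fin 2) (Fin 2) ℂ) :
    translate t (site v M) = site (v + t) M := Subtype.ext (translateConj_siteOp t v M)

/-- `ω` is a translation invariant ground state of the color code.  The translations that map the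
lattice to itself are those by vectors `(p, q)` with `p + q` even. -/
structure IsInvariantGroundState (ω : PosFunctional) : Prop where
  map_one : ω 1 = 1
  ground : ∀ (Λ : Finset Vertex), ∀ A ∈ localAlg (Λ : Set Vertex),
    0 ≤ -Complex.I * ω (star A * derivation Λ A)
  invariant : ∀ t : ℤ × ℤ, Even (t.1 + t.2) → ∀ A : Obs, ω (translate t A) = ω A

/-! ### String operators and string automorphisms -/

/-- A half-infinite string of color `c`, `(f₀, v₀, v₁, f₁, v₂, v₃, f₂, …)`, without repeated
vertices: here `face i = f_i`, `src i = v_{2i}` and `tgt i = v_{2i+1}`. -/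
structure HalfString (c : Color) where
  face : ℕ → Face
  src : ℕ → Vertex
  tgt : ℕ → Vertex
  color_face : ∀ i, (face i).color = c
  face_ne : ∀ i, face i ≠ face (i + 1)
  src_mem : ∀ i, src i ∈ (face i).boundary
  tgt_mem : ∀ i, tgt i ∈ (face (i + 1)).boundary
  adj : ∀ i, lattice.Adj (src i) (tgt i)
  src_injective : Function.Injective src
  tgt_injective : Function.Injective tgt
  src_ne_tgt : ∀ i j, src i ≠ tgt j

/-- The string of color `c` that goes vertically downwards. -/
def verticalString : (c : Color) → HalfString c := fun c =>
  let x : ℤ := match c with | .r => 0 | .g => 1 | .b => 2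
  { face := fun i => ⟨(x, 1 - x - 2 * i), by simp only; exact ⟨-i, by ring⟩⟩
    src := fun i => (x + 1, 1 - x - 2 * i)
    tgt := fun i => (x + 1, 1 - x - 2 * i - 1)
    color_face := by intro i; cases c <;> simp [Face.color, x]
    face_ne := by intro i h; simp at h
    src_mem := by intro i; simp [Face.boundary, brick]
    tgt_mem := by
      intro i
      refine List.mem_map.2 ⟨(1, 1), by simp [brick], ?_⟩
      ext
      · simp
      · simp; ring
    adj := by
      intro i
      rw [lattice, SimpleGraph.fromRel_adj]
      refine ⟨fun h => by have := congrArg Prod.snd h; simp only at this; omega, Or.inr (Or.inr ⟨⟨-i + 0, by simp; ring⟩, by simp⟩)⟩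
    src_injective := by intro i j h; simpa using h
    tgt_injective := by intro i j h; simpa using h
    src_ne_tgt := by intro i j h; simp at h; omega }

/-- The support of the finite string formed by the first `n + 1` faces of `γ`. -/
def HalfString.vertices {c : Color} (γ : HalfString c) (n : ℕ) : List Vertex :=
  (List.range n).flatMap fun i => [γ.src i, γ.tgt i]

/-- The string operator of type `k` on the vertices in a list. -/
def stringOp (l : List Vertex) : Pauli → Obs
  | .x => siteProd l sigmaX
  | .z => siteProd l sigmaZ
  | .y => siteProd l sigmaX * siteProd l sigmaZ

theorem sigmaX_mem_unitary : sigmaX ∈ unitary (Matrix (Fin 2) (Fin 2) ℂ) := by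
  rw [Unitary.mem_iff]
  constructor <;>
  · ext i j
    fin_cases i <;> fin_cases j <;> simp [sigmaX, Matrix.mul_apply, Matrix.star_apply]

theorem sigmaZ_mem_unitary : sigmaZ ∈ unitary (Matrix (Fin 2) (Fin 2) ℂ) := by
  rw [Unitary.mem_iff]
  constructor <;>
  · ext i j
    fin_cases i <;> fin_cases j <;> simp [sigmaZ, Matrix.mul_apply, Matrix.star_apply]

theorem site_mem_unitary (v : Vertex) {M : Matrix (Fin 2) (Fin 2) ℂ}
    (hM : M ∈ unitary (Matrix (Fin 2) (Fin 2) ℂ)) : site v M ∈ unitary Obs := by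
  rw [Unitary.mem_iff] at hM ⊢
  rw [← site_star, ← site_mul, ← site_mul, hM.1, hM.2]
  exact ⟨site_one v, site_one v⟩

theorem siteProd_mem_unitary (l : List Vertex) {M : Matrix (Fin 2) (Fin 2) ℂ}
    (hM : M ∈ unitary (Matrix (Fin 2) (Fin 2) ℂ)) : siteProd l M ∈ unitary Obs := by
  refine Submonoid.list_prod_mem _ fun a ha => ?_
  obtain ⟨v, -, rfl⟩ := List.mem_map.1 ha
  exact site_mem_unitary v hM

theorem stringOp_mem_unitary (l : List Vertex) (k : Pauli) : stringOp l k ∈ unitary Obs := by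
  cases k
  · exact siteProd_mem_unitary l sigmaX_mem_unitary
  · exact Submonoid.mul_mem _ (siteProd_mem_unitary l sigmaX_mem_unitary)
      (siteProd_mem_unitary l sigmaZ_mem_unitary)
  · exact siteProd_mem_unitary l sigmaZ_mem_unitary

/-- The map `A ↦ S* A S` for the string operator `S` of type `k` on the vertices in a list. -/
def stringConj (l : List Vertex) (k : Pauli) : Obs →⋆ₐ[ℂ] Obs :=
  (Unitary.conjStarAlgAut ℂ Obs (star ⟨stringOp l k, stringOp_mem_unitary l k⟩) : Obs ≃⋆ₐ[ℂ] Obs)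

theorem stringConj_apply (l : List Vertex) (k : Pauli) (A : Obs) :
    stringConj l k A = star (stringOp l k) * A * stringOp l k := by
  change _ * A * star (star (stringOp l k)) = _
  rw [star_star]; rfl

/-- Conjugation of a one-qubit observable at `v` by `siteProd l P`. -/
theorem siteProd_conj_site (l : List Vertex) {P : Matrix (Fin 2) (Fin 2) ℂ}
    (hP : P ∈ unitary (Matrix (Fin 2) (Fin 2) ℂ)) (v : Vertex) (M : Matrix (Fin 2) (Fin 2) ℂ) :
    star (siteProd l P) * site v M * siteProd l P =
      site v (l.foldl (fun N w => if w = v then star P * N * P else N) M) := by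
  induction l generalizing M with
  | nil => simp [siteProd]
  | cons w l ih =>
    have h : star (site w P) * site v M * site w P =
        site v (if w = v then star P * M * P else M) := by
      split_ifs with hw
      · subst hw; rw [site_mul, site_mul, site_star]
      · rw [mul_assoc, site_comm (Ne.symm hw), ← mul_assoc,
          (Unitary.mem_iff.1 (site_mem_unitary w hP)).1, one_mul]
    have hc : siteProd (w :: l) P = site w P * siteProd l P := by simp [siteProd]
    rw [hc, List.foldl_cons, ← ih, ← h, star_mul]
    simp only [mul_assoc]

theorem HalfString.eventually_foldl {c : Color} (γ : HalfString c) (v : Vertex)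
    (P M : Matrix (Fin 2) (Fin 2) ℂ) : ∃ N : Matrix (Fin 2) (Fin 2) ℂ, ∀ᶠ n in Filter.atTop,
      (γ.vertices n).foldl (fun N w => if w = v then star P * N * P else N) M = N := by
  have h1 : ∀ᶠ n in Filter.atTop, γ.src n ≠ v := by
    have := γ.src_injective.tendsto_cofinite.eventually (Set.finite_singleton v).compl_mem_cofinite
    rwa [Nat.cofinite_eq_atTop] at this
  have h2 : ∀ᶠ n in Filter.atTop, γ.tgt n ≠ v := by
    have := γ.tgt_injective.tendsto_cofinite.eventually (Set.finite_singleton v).compl_mem_cofinite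
    rwa [Nat.cofinite_eq_atTop] at this
  obtain ⟨n₀, hn₀⟩ := Filter.eventually_atTop.1 (h1.and h2)
  refine ⟨(γ.vertices n₀).foldl (fun N w => if w = v then star P * N * P else N) M,
    Filter.eventually_atTop.2 ⟨n₀, fun n hn => ?_⟩⟩
  induction n, hn using Nat.le_induction with
  | base => rfl
  | succ n hn ih =>
    rw [← ih, HalfString.vertices, List.range_succ, List.flatMap_append, List.foldl_append,
      ← HalfString.vertices]
    simp [(hn₀ n hn).1, (hn₀ n hn).2]

/-- The sequence `S_{γ_n}* A S_{γ_n}` is eventually constant for a one-qubit observable `A`. -/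
theorem HalfString.exists_lim_site {c : Color} (γ : HalfString c) (k : Pauli) (v : Vertex)
    (M : Matrix (Fin 2) (Fin 2) ℂ) :
    ∃ b, Filter.Tendsto (fun n => stringConj (γ.vertices n) k (site v M)) Filter.atTop (nhds b) := by
  suffices ∃ N, ∀ᶠ n in Filter.atTop, stringConj (γ.vertices n) k (site v M) = site v N by
    obtain ⟨N, hN⟩ := this
    exact ⟨site v N, tendsto_const_nhds.congr' (hN.mono fun n hn => hn.symm)⟩
  cases k
  · obtain ⟨N, hN⟩ := γ.eventually_foldl v sigmaX M
    exact ⟨N, hN.mono fun n hn => by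
      rw [stringConj_apply, stringOp, siteProd_conj_site _ sigmaX_mem_unitary, hn]⟩
  · obtain ⟨N, hN⟩ := γ.eventually_foldl v sigmaX M
    obtain ⟨N', hN'⟩ := γ.eventually_foldl v sigmaZ N
    refine ⟨N', (hN.and hN').mono fun n hn => ?_⟩
    have := siteProd_conj_site (γ.vertices n) sigmaX_mem_unitary v M
    rw [hn.1] at this
    have h' := siteProd_conj_site (γ.vertices n) sigmaZ_mem_unitary v N
    rw [hn.2, ← this] at h'
    rw [stringConj_apply, stringOp, ← h', star_mul]
    simp only [mul_assoc]
  · obtain ⟨N, hN⟩ := γ.eventually_foldl v sigmaZ M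
    exact ⟨N, hN.mono fun n hn => by
      rw [stringConj_apply, stringOp, siteProd_conj_site _ sigmaZ_mem_unitary, hn]⟩

/-- Pointwise convergence of `*`-homomorphisms on the one-qubit observables extends to `𝒜`. -/
theorem exists_lim_of_site (φ : ℕ → Obs →⋆ₐ[ℂ] Obs)
    (h : ∀ v M, ∃ b, Filter.Tendsto (fun n => φ n (site v M)) Filter.atTop (nhds b)) (a : Obs) :
    ∃ b, Filter.Tendsto (fun n => φ n a) Filter.atTop (nhds b) := by
  let S : StarSubalgebra ℂ Obs :=
    { carrier := {a | ∃ b, Filter.Tendsto (fun n => φ n a) Filter.atTop (nhds b)}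
      mul_mem' := fun ⟨b, hb⟩ ⟨c, hc⟩ => ⟨b * c, by simpa using hb.mul hc⟩
      add_mem' := fun ⟨b, hb⟩ ⟨c, hc⟩ => ⟨b + c, by simpa using hb.add hc⟩
      algebraMap_mem' := fun r => ⟨algebraMap ℂ Obs r, by
        simpa only [AlgHomClass.commutes] using tendsto_const_nhds⟩
      star_mem' := fun ⟨b, hb⟩ => ⟨star b, by simpa only [map_star] using hb.star⟩ }
  refine Obs.mem_of_isClosed S ?_ h a
  refine isClosed_of_closure_subset fun a ha => ?_
  refine cauchySeq_tendsto_of_complete (Metric.cauchySeq_iff'.2 fun ε hε => ?_)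
  obtain ⟨a', ⟨b, hb⟩, hd⟩ := Metric.mem_closure_iff.1 ha (ε / 3) (by positivity)
  obtain ⟨N, hN⟩ := Metric.cauchySeq_iff'.1 hb.cauchySeq (ε / 3) (by positivity)
  refine ⟨N, fun n hn => ?_⟩
  have hφ : ∀ m, dist (φ m a) (φ m a') < ε / 3 := fun m => by
    rw [dist_eq_norm, ← map_sub]
    refine lt_of_le_of_lt (NonUnitalStarAlgHom.norm_apply_le (φ m) _) ?_
    rwa [← dist_eq_norm]
  have h1 := dist_triangle4 (φ n a) (φ n a') (φ N a') (φ N a)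
  have h2 := hφ n
  have h3 := hN n hn
  have h4 := hφ N
  rw [dist_comm] at h4
  linarith

theorem HalfString.exists_lim {c : Color} (γ : HalfString c) (k : Pauli) (A : Obs) :
    ∃ b, Filter.Tendsto (fun n => stringConj (γ.vertices n) k A) Filter.atTop (nhds b) :=
  exists_lim_of_site _ (γ.exists_lim_site k) A

/-- `ρ_γ^{ck}(A) = lim_n S_{γ_n}* A S_{γ_n}`, as a function on `𝒜`. -/
def HalfString.rhoFun {c : Color} (γ : HalfString c) (k : Pauli) (A : Obs) : Obs :=
  (γ.exists_lim k A).choose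

theorem HalfString.tendsto_rhoFun {c : Color} (γ : HalfString c) (k : Pauli) (A : Obs) :
    Filter.Tendsto (fun n => stringConj (γ.vertices n) k A) Filter.atTop (nhds (γ.rhoFun k A)) :=
  (γ.exists_lim k A).choose_spec

/-- The endomorphism `ρ_γ^{ck}` of `𝒜`. -/
def HalfString.rho {c : Color} (γ : HalfString c) (k : Pauli) : Obs →⋆ₐ[ℂ] Obs where
  toFun := γ.rhoFun k
  map_one' := tendsto_nhds_unique (γ.tendsto_rhoFun k 1) (by
    simpa only [map_one] using tendsto_const_nhds)
  map_mul' a b := tendsto_nhds_unique (γ.tendsto_rhoFun k (a * b)) (by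
    simpa only [map_mul] using (γ.tendsto_rhoFun k a).mul (γ.tendsto_rhoFun k b))
  map_zero' := tendsto_nhds_unique (γ.tendsto_rhoFun k 0) (by
    simpa only [map_zero] using tendsto_const_nhds)
  map_add' a b := tendsto_nhds_unique (γ.tendsto_rhoFun k (a + b)) (by
    simpa only [map_add] using (γ.tendsto_rhoFun k a).add (γ.tendsto_rhoFun k b))
  commutes' r := tendsto_nhds_unique (γ.tendsto_rhoFun k (algebraMap ℂ Obs r)) (by
    simpa only [AlgHomClass.commutes] using tendsto_const_nhds)
  map_star' a := tendsto_nhds_unique (γ.tendsto_rhoFun k (star a)) (by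
    simpa only [map_star] using (γ.tendsto_rhoFun k a).star)

/-! ### Representations and superselection sectors -/

/-- The functional `ω ∘ ρ`. -/
def pullback (ω : PosFunctional) (ρ : Obs →⋆ₐ[ℂ] Obs) : PosFunctional :=
  ω.comp (PositiveLinearMap.ofClass ρ)

theorem pullback_apply (ω : PosFunctional) (ρ : Obs →⋆ₐ[ℂ] Obs) (a : Obs) :
    pullback ω ρ a = ω (ρ a) := rfl

/-- The GNS representations of `ω₁` and `ω₂`, restricted to the observables in `B`, are unitarily
equivalent. -/
def EquivOn (B : StarSubalgebra ℂ Obs) (ω₁ ω₂ : PosFunctional) : Prop :=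
  ∃ U : ω₁.GNS ≃ₗᵢ[ℂ] ω₂.GNS, ∀ a ∈ B, ∀ ξ : ω₁.GNS,
    U (ω₁.gnsStarAlgHom a ξ) = ω₂.gnsStarAlgHom a (U ξ)

/-- The GNS representations of `ω₁` and `ω₂` are unitarily equivalent. -/
def GNSEquiv (ω₁ ω₂ : PosFunctional) : Prop := EquivOn ⊤ ω₁ ω₂

/-- The position of a vertex in the plane. -/
def position (v : Vertex) : EuclideanSpace ℝ (Fin 2) := !₂[(v.1 : ℝ), (v.2 : ℝ)]

/-- The vertices in the cone with apex `p`, axis `a` and half-opening angle `θ`. -/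
def cone (p a : EuclideanSpace ℝ (Fin 2)) (θ : ℝ) : Set Vertex :=
  {v | ‖position v - p‖ * Real.cos θ < inner ℝ (position v - p) a}

/-- The GNS representation of `ω` satisfies the superselection criterion with respect to the GNS
representation of `ω₀`. -/
def IsSuperselectionSector (ω₀ ω : PosFunctional) : Prop :=
  ∀ (p a : EuclideanSpace ℝ (Fin 2)) (θ : ℝ), ‖a‖ = 1 → 0 < θ → θ < Real.pi →
    EquivOn (localAlg (cone p a θ)ᶜ) ω ω₀

/-- A string type `ck`: a color together with a Pauli label. -/
structure StringType where
  color : Color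
  pauli : Pauli

/-- The state `ω₀ ∘ ρ_γ^{ck}`, whose GNS representation is `π^{ck}`. -/
def stringState (ω₀ : PosFunctional) (s : StringType) (γ : HalfString s.color) : PosFunctional :=
  pullback ω₀ (γ.rho s.pauli)

/-- The state `ω₀ ∘ ρ_γ^{ck} ∘ ρ_γ'^{c'k'}`, whose GNS representation is `π^{ck,c'k'}`. -/
def compositeState (ω₀ : PosFunctional) (s t : StringType)
    (γ : HalfString s.color) (γ' : HalfString t.color) : PosFunctional :=
  pullback ω₀ ((γ.rho s.pauli).comp (γ'.rho t.pauli))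

def rx : StringType := ⟨.r, .x⟩
def ry : StringType := ⟨.r, .y⟩
def rz : StringType := ⟨.r, .z⟩
def gx : StringType := ⟨.g, .x⟩
def gy : StringType := ⟨.g, .y⟩
def gz : StringType := ⟨.g, .z⟩
def bx : StringType := ⟨.b, .x⟩
/-- The type blue-`y` (`by` is a reserved word). -/
def bY : StringType := ⟨.b, .y⟩
def bz : StringType := ⟨.b, .z⟩

/-- The three pairs of bosonic strings for each of the six fermions `f₁, …, f₆`. -/
def fermionPairs : Fin 6 → Fin 3 → StringType × StringType :=
  ![![(rx, bz), (ry, gz), (gx, bY)],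
    ![(rz, bx), (ry, gx), (gz, bY)],
    ![(bz, gy), (gx, rz), (bx, ry)],
    ![(rz, gy), (gx, bz), (rx, bY)],
    ![(rx, gy), (bx, gz), (bY, rz)],
    ![(bx, gy), (rx, gz), (ry, bz)]]

end ColorCode

end

open ColorCode

/-!
Two products of Pauli matrices commute or anticommute, so each of them has a syndrome: the set of
faces at which it flips the sign of the stabilizer. A state is determined by the signs with which it
stabilizes the faces, because the vanishing of the homology of the lattice makes every finite Pauli
operator without syndrome a product of stabilizers. A state without violated stabilizers is an
invariant ground state. Conversely, in an invariant ground state no two faces of the same color are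
excited simultaneously, as the ground state inequality shows when tested on an operator moving one
excitation onto the other; since infinitely many faces of that color are excited with the same
probability, this probability is zero.

Each of the two types of stabilizers contributes to the charge of a syndrome an element of
`{q : Color → ZMod 2 | ∑ c, q c = 0}`, which records for each color the parity of the number of
violated faces of the other two colors. Syndromes with equal charges differ by that of a finite
Pauli operator, so their states are unitarily equivalent. The product of all stabilizers of two
colors in a large region is supported near the boundary of the region and measures the charge
inside, so that the charge is an invariant of the representation. A charge can be brought in from
infinity along a path inside any cone, which gives the superselection criterion, and the
classification of the sectors becomes a finite computation with charges.
-/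

noncomputable section

namespace ColorCode

open Filter Topology
open scoped symmDiff

/-! ### Parities -/

theorem eq_zero_or_eq_one (z : ZMod 2) : z = 0 ∨ z = 1 :=
  (eq_or_ne z 0).imp_right (Fin.eq_one_of_ne_zero z)

/-- The nontrivial character of `ZMod 2`, which turns parities of intersections into the signs in
the commutation relations of Pauli operators. -/
def paritySign : AddChar (ZMod 2) ℂ := AddChar.zmodChar 2 neg_one_sq

@[simp] theorem paritySign_one : paritySign 1 = -1 := by
  simp [paritySign, AddChar.zmodChar_apply, ZMod.val_one]

theorem paritySign_injective : Function.Injective paritySign := by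
  intro z z' h
  rcases eq_zero_or_eq_one z with rfl | rfl <;> rcases eq_zero_or_eq_one z' with rfl | rfl <;>
    first | rfl | norm_num at h

@[simp] theorem paritySign_mul_self (z : ZMod 2) : paritySign z * paritySign z = 1 := by
  rw [← AddChar.map_add_eq_mul, CharTwo.add_self_eq_zero, AddChar.map_zero_eq_one]

section Parity

variable {α : Type*} [DecidableEq α]

theorem insert_eq_symmDiff {x : α} {s : Finset α} (h : x ∉ s) : insert x s = {x} ∆ s := by
  rw [Finset.symmDiff_eq_union (Finset.disjoint_singleton_left.2 h), Finset.insert_eq]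

theorem sum_symmDiff {R : Type*} [Semiring R] [CharP R 2] (q : α → R) (a b : Finset α) :
    ∑ x ∈ a ∆ b, q x = ∑ x ∈ a, q x + ∑ x ∈ b, q x := by
  have hsplit (a b : Finset α) : ∑ x ∈ a, q x = ∑ x ∈ a \ b, q x + ∑ x ∈ a ∩ b, q x := by
    rw [← Finset.sum_union (Finset.disjoint_sdiff_inter a b), Finset.sdiff_union_inter]
  rw [symmDiff_def, Finset.sup_eq_union, Finset.sum_union disjoint_sdiff_sdiff, hsplit a b,
    hsplit b a, Finset.inter_comm b a, add_add_add_comm, CharTwo.add_self_eq_zero, add_zero]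

/-- The parity of the number of common elements of two finite sets, the bilinear pairing on finite
sets under symmetric difference. -/
def interParity (a b : Finset α) : ZMod 2 := ((a ∩ b).card : ZMod 2)

theorem interParity_comm (a b : Finset α) : interParity a b = interParity b a := by
  rw [interParity, interParity, Finset.inter_comm]

theorem interParity_eq_sum (a b : Finset α) :
    interParity a b = ∑ x ∈ b, if x ∈ a then 1 else 0 := by
  rw [Finset.sum_boole, interParity, Finset.inter_comm, Finset.filter_mem_eq_inter]

theorem interParity_symmDiff_right (a b b' : Finset α) :
    interParity a (b ∆ b') = interParity a b + interParity a b' := by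
  simp only [interParity_eq_sum, sum_symmDiff]

theorem interParity_symmDiff_left (a a' b : Finset α) :
    interParity (a ∆ a') b = interParity a b + interParity a' b := by
  simp only [interParity_comm _ b, interParity_symmDiff_right]

@[simp] theorem interParity_empty_left (b : Finset α) : interParity ∅ b = 0 := by
  simp [interParity]

@[simp] theorem interParity_empty_right (a : Finset α) : interParity a ∅ = 0 := by
  simp [interParity]

theorem interParity_singleton_right (a : Finset α) (x : α) :
    interParity a {x} = if x ∈ a then 1 else 0 := by
  rw [interParity_eq_sum, Finset.sum_singleton]

theorem interParity_singleton_left (x : α) (b : Finset α) :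
    interParity {x} b = if x ∈ b then 1 else 0 := by
  rw [interParity_comm, interParity_singleton_right]

theorem interParity_image {β : Type*} [DecidableEq β] {φ : α → β} (hφ : Function.Injective φ)
    (a b : Finset α) : interParity (a.image φ) (b.image φ) = interParity a b := by
  rw [interParity, interParity, ← Finset.image_inter _ _ hφ, Finset.card_image_of_injective _ hφ]

theorem eq_of_interParity_singleton_eq {a b : Finset α}
    (h : ∀ x, interParity a {x} = interParity b {x}) : a = b := by
  ext x
  have hx := h x
  simp only [interParity_singleton_right] at hx
  by_cases ha : x ∈ a <;> by_cases hb : x ∈ b <;> simp_all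

theorem exists_ne_mem_of_interParity_eq_zero {a b : Finset α} (h : interParity a b = 0) {x : α}
    (ha : x ∈ a) (hb : x ∈ b) : ∃ y ∈ a, y ∈ b ∧ y ≠ x := by
  have heven : Even (a ∩ b).card := ZMod.natCast_eq_zero_iff_even.1 h
  have hx : x ∈ a ∩ b := Finset.mem_inter.2 ⟨ha, hb⟩
  have hcard : 1 < (a ∩ b).card := by
    obtain ⟨r, hr⟩ := heven
    have := Finset.card_pos.2 ⟨x, hx⟩
    omega
  obtain ⟨y, hy, hne⟩ := Finset.exists_mem_ne hcard x
  exact ⟨y, (Finset.mem_inter.1 hy).1, (Finset.mem_inter.1 hy).2, hne⟩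

end Parity

/-! ### Pauli operators -/

theorem toOp_injective : Function.Injective Obs.toOp := Subtype.val_injective

theorem Obs.ext_apply {a b : Obs} (h : ∀ ψ s, Obs.toOp a ψ s = Obs.toOp b ψ s) : a = b :=
  toOp_injective (ContinuousLinearMap.ext fun ψ => lp.ext (funext (h ψ)))

theorem toOp_mul_apply (a b : Obs) (ψ : ConfigSpace) :
    Obs.toOp (a * b) ψ = Obs.toOp a (Obs.toOp b ψ) := by
  rw [map_mul]; rfl

theorem toOp_smul_apply (c : ℂ) (a : Obs) (ψ : ConfigSpace) (s : Finset Vertex) :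
    Obs.toOp (c • a) ψ s = c * Obs.toOp a ψ s := by
  rw [map_smul]; rfl

theorem toOp_site_apply (v : Vertex) (M : Matrix (Fin 2) (Fin 2) ℂ) (ψ : ConfigSpace)
    (s : Finset Vertex) : Obs.toOp (site v M) ψ s =
      M (spin v s) (spin v s) * ψ s + M (spin v s) (1 - spin v s) * ψ (flip v s) := rfl

theorem toOp_site_sigmaX (v : Vertex) (ψ : ConfigSpace) (s : Finset Vertex) :
    Obs.toOp (site v sigmaX) ψ s = ψ (s ∆ {v}) := by
  rw [toOp_site_apply, flip_apply]
  by_cases h : v ∈ s <;> simp [spin, h, sigmaX]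

theorem toOp_site_sigmaZ (v : Vertex) (ψ : ConfigSpace) (s : Finset Vertex) :
    Obs.toOp (site v sigmaZ) ψ s = paritySign (interParity s {v}) * ψ s := by
  rw [toOp_site_apply, interParity_singleton_right]
  by_cases h : v ∈ s <;> simp [spin, h, sigmaZ]

/-- The two types of Pauli operators of a CSS code: products of `σ^x` and products of `σ^z`. -/
inductive CSSType
  | x | z
  deriving DecidableEq

namespace CSSType

/-- The other type: stabilizers of type `k.dual` detect operators of type `k`. -/
def dual : CSSType → CSSType
  | x => z
  | z => x

@[simp] theorem dual_dual (k : CSSType) : k.dual.dual = k := by cases k <;> rfl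

/-- The Pauli matrix of a type. -/
def matrix : CSSType → Matrix (Fin 2) (Fin 2) ℂ
  | x => sigmaX
  | z => sigmaZ

theorem matrix_mem_unitary (k : CSSType) : k.matrix ∈ unitary (Matrix (Fin 2) (Fin 2) ℂ) := by
  cases k
  exacts [sigmaX_mem_unitary, sigmaZ_mem_unitary]

end CSSType

/-- The product of the Pauli operators of type `k` over a finite set of vertices. -/
def pauliOp (k : CSSType) (a : Finset Vertex) : Obs := siteProd a.toList k.matrix

theorem siteProd_cons (v : Vertex) (l : List Vertex) (M : Matrix (Fin 2) (Fin 2) ℂ) :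
    siteProd (v :: l) M = site v M * siteProd l M := by
  simp [siteProd]

theorem toFinset_cons_eq_symmDiff {v : Vertex} {l : List Vertex} (h : v ∉ l) :
    (v :: l).toFinset = {v} ∆ l.toFinset := by
  rw [List.toFinset_cons, insert_eq_symmDiff (by simpa using h)]

theorem toOp_siteProd_sigmaX {l : List Vertex} (hl : l.Nodup) (ψ : ConfigSpace)
    (s : Finset Vertex) : Obs.toOp (siteProd l sigmaX) ψ s = ψ (s ∆ l.toFinset) := by
  induction l generalizing s with
  | nil => simp [siteProd, ← Finset.bot_eq_empty]
  | cons v l ih =>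
    obtain ⟨hv, hl⟩ := List.nodup_cons.1 hl
    rw [siteProd_cons, toOp_mul_apply, toOp_site_sigmaX, ih hl, toFinset_cons_eq_symmDiff hv,
      symmDiff_assoc]

theorem toOp_siteProd_sigmaZ {l : List Vertex} (hl : l.Nodup) (ψ : ConfigSpace)
    (s : Finset Vertex) :
    Obs.toOp (siteProd l sigmaZ) ψ s = paritySign (interParity s l.toFinset) * ψ s := by
  induction l with
  | nil => simp [siteProd]
  | cons v l ih =>
    obtain ⟨hv, hl⟩ := List.nodup_cons.1 hl
    rw [siteProd_cons, toOp_mul_apply, toOp_site_sigmaZ, ih hl, toFinset_cons_eq_symmDiff hv,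
      interParity_symmDiff_right, AddChar.map_add_eq_mul, mul_assoc]

theorem toOp_pauliOp_x (a : Finset Vertex) (ψ : ConfigSpace) (s : Finset Vertex) :
    Obs.toOp (pauliOp .x a) ψ s = ψ (s ∆ a) := by
  rw [pauliOp, CSSType.matrix, toOp_siteProd_sigmaX a.nodup_toList, Finset.toList_toFinset]

theorem toOp_pauliOp_z (a : Finset Vertex) (ψ : ConfigSpace) (s : Finset Vertex) :
    Obs.toOp (pauliOp .z a) ψ s = paritySign (interParity s a) * ψ s := by
  rw [pauliOp, CSSType.matrix, toOp_siteProd_sigmaZ a.nodup_toList, Finset.toList_toFinset]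

theorem siteProd_eq_pauliOp {l : List Vertex} (hl : l.Nodup) (k : CSSType) :
    siteProd l k.matrix = pauliOp k l.toFinset := by
  refine Obs.ext_apply fun ψ s => ?_
  cases k
  · rw [toOp_pauliOp_x, CSSType.matrix, toOp_siteProd_sigmaX hl]
  · rw [toOp_pauliOp_z, CSSType.matrix, toOp_siteProd_sigmaZ hl]

theorem pauliOp_mul (k : CSSType) (a b : Finset Vertex) :
    pauliOp k a * pauliOp k b = pauliOp k (a ∆ b) := by
  refine Obs.ext_apply fun ψ s => ?_
  rw [toOp_mul_apply]
  cases k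
  · simp only [toOp_pauliOp_x, symmDiff_assoc]
  · simp only [toOp_pauliOp_z, interParity_symmDiff_right, AddChar.map_add_eq_mul, mul_assoc]

@[simp] theorem pauliOp_empty (k : CSSType) : pauliOp k ∅ = 1 := by simp [pauliOp, siteProd]

theorem pauliOp_singleton (k : CSSType) (v : Vertex) : pauliOp k {v} = site v k.matrix := by
  simp [pauliOp, siteProd]

@[simp] theorem pauliOp_mul_self (k : CSSType) (a : Finset Vertex) :
    pauliOp k a * pauliOp k a = 1 := by
  simp [pauliOp_mul]

theorem pauliOp_mem_unitary (k : CSSType) (a : Finset Vertex) : pauliOp k a ∈ unitary Obs :=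
  siteProd_mem_unitary _ k.matrix_mem_unitary

@[simp] theorem star_pauliOp (k : CSSType) (a : Finset Vertex) :
    star (pauliOp k a) = pauliOp k a :=
  left_inv_eq_right_inv (Unitary.mem_iff.1 (pauliOp_mem_unitary k a)).1 (pauliOp_mul_self k a)

theorem pauliOp_comm (k : CSSType) (a b : Finset Vertex) :
    pauliOp k a * pauliOp k b = pauliOp k b * pauliOp k a := by
  rw [pauliOp_mul, pauliOp_mul, symmDiff_comm]

theorem pauliOp_mul_pauliOp_dual (k : CSSType) (a b : Finset Vertex) :
    pauliOp k a * pauliOp k.dual b =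
      paritySign (interParity a b) • (pauliOp k.dual b * pauliOp k a) := by
  have hxz (a b) : pauliOp .x a * pauliOp .z b =
      paritySign (interParity a b) • (pauliOp .z b * pauliOp .x a) := by
    refine Obs.ext_apply fun ψ s => ?_
    simp only [toOp_mul_apply, toOp_smul_apply, toOp_pauliOp_x, toOp_pauliOp_z,
      interParity_symmDiff_left, AddChar.map_add_eq_mul]
    ring
  cases k
  · exact hxz a b
  · rw [CSSType.dual, hxz b a, smul_smul, interParity_comm, paritySign_mul_self, one_smul]

theorem site_mem_localAlg {Λ : Set Vertex} {v : Vertex} (hv : v ∈ Λ)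
    (M : Matrix (Fin 2) (Fin 2) ℂ) : site v M ∈ localAlg Λ :=
  StarSubalgebra.le_topologicalClosure _ (StarAlgebra.subset_adjoin ℂ _ ⟨v, hv, M, rfl⟩)

theorem pauliOp_mem_localAlg {Λ : Set Vertex} (k : CSSType) {a : Finset Vertex}
    (ha : (a : Set Vertex) ⊆ Λ) : pauliOp k a ∈ localAlg Λ := by
  refine list_prod_mem fun x hx => ?_
  obtain ⟨v, hv, rfl⟩ := List.mem_map.1 hx
  exact site_mem_localAlg (ha (by simpa using hv)) _

theorem siteProd_comm_site {l : List Vertex} {v : Vertex} (h : v ∉ l)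
    (M N : Matrix (Fin 2) (Fin 2) ℂ) : Commute (siteProd l M) (site v N) := by
  refine Commute.list_prod_left _ _ fun x hx => ?_
  obtain ⟨w, hw, rfl⟩ := List.mem_map.1 hx
  exact site_comm (ne_of_mem_of_not_mem hw h) _ _

theorem pauliOp_comm_site (k : CSSType) {a : Finset Vertex} {v : Vertex} (h : v ∉ a)
    (M : Matrix (Fin 2) (Fin 2) ℂ) : Commute (pauliOp k a) (site v M) :=
  siteProd_comm_site (by simpa using h) _ _

/-! ### Density of the Pauli operators -/

theorem site_add (v : Vertex) (M N : Matrix (Fin 2) (Fin 2) ℂ) :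
    site v (M + N) = site v M + site v N := by
  refine Obs.ext_apply fun ψ s => ?_
  have hadd : Obs.toOp (site v M + site v N) ψ s =
    Obs.toOp (site v M) ψ s + Obs.toOp (site v N) ψ s := rfl
  simp only [hadd, toOp_site_apply, Matrix.add_apply]
  ring

theorem site_smul (v : Vertex) (c : ℂ) (M : Matrix (Fin 2) (Fin 2) ℂ) :
    site v (c • M) = c • site v M := by
  refine Obs.ext_apply fun ψ s => ?_
  simp only [toOp_smul_apply, toOp_site_apply, Matrix.smul_apply, smul_eq_mul]
  ring

theorem matrix_eq_pauli_expansion (M : Matrix (Fin 2) (Fin 2) ℂ) :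
    M = ((M 0 0 + M 1 1) / 2) • (1 : Matrix (Fin 2) (Fin 2) ℂ) + ((M 0 0 - M 1 1) / 2) • sigmaZ +
      ((M 0 1 + M 1 0) / 2) • sigmaX + ((M 1 0 - M 0 1) / 2) • (sigmaX * sigmaZ) := by
  ext i j
  fin_cases i <;> fin_cases j <;> simp [sigmaX, sigmaZ] <;> ring

/-- The monomials `X(a) Z(b)` in the Pauli operators, closed under products up to scalars. -/
def pauliMonomial (p : CSSType → Finset Vertex) : Obs := pauliOp .x (p .x) * pauliOp .z (p .z)

theorem pauliMonomial_mul (p q : CSSType → Finset Vertex) :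
    pauliMonomial p * pauliMonomial q =
      paritySign (interParity (p .z) (q .x)) • pauliMonomial fun k => p k ∆ q k := by
  have hzx := pauliOp_mul_pauliOp_dual .z (p .z) (q .x)
  rw [CSSType.dual] at hzx
  simp only [pauliMonomial]
  rw [← pauliOp_mul, ← pauliOp_mul, mul_assoc, ← mul_assoc (pauliOp .z _), hzx]
  simp only [smul_mul_assoc, mul_smul_comm, mul_assoc]

theorem pauliMonomial_mem_unitary (p : CSSType → Finset Vertex) : pauliMonomial p ∈ unitary Obs :=
  mul_mem (pauliOp_mem_unitary _ _) (pauliOp_mem_unitary _ _)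

theorem pauliOp_dual_mul_pauliMonomial (k : CSSType) (b : Finset Vertex)
    (p : CSSType → Finset Vertex) : pauliOp k.dual b * pauliMonomial p =
      paritySign (interParity (p k) b) • (pauliMonomial p * pauliOp k.dual b) := by
  have h := pauliOp_mul_pauliOp_dual k.dual b (p k)
  rw [CSSType.dual_dual, interParity_comm] at h
  cases k <;> rw [CSSType.dual] at h ⊢
  · rw [pauliMonomial, ← mul_assoc, h, smul_mul_assoc, mul_assoc, pauliOp_comm .z b, mul_assoc]
  · rw [pauliMonomial, ← mul_assoc, pauliOp_comm .x b, mul_assoc, h, mul_smul_comm, mul_assoc]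

theorem star_pauliMonomial (p : CSSType → Finset Vertex) :
    star (pauliMonomial p) = paritySign (interParity (p .z) (p .x)) • pauliMonomial p := by
  rw [pauliMonomial, star_mul, star_pauliOp, star_pauliOp]
  exact pauliOp_mul_pauliOp_dual .z (p .z) (p .x)

theorem mul_mem_span_pauliMonomial {x y : Obs} (hx : x ∈ Submodule.span ℂ (Set.range pauliMonomial))
    (hy : y ∈ Submodule.span ℂ (Set.range pauliMonomial)) :
    x * y ∈ Submodule.span ℂ (Set.range pauliMonomial) := by
  have hle : Submodule.span ℂ (Set.range pauliMonomial) * Submodule.span ℂ (Set.range pauliMonomial)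
      ≤ Submodule.span ℂ (Set.range pauliMonomial) := by
    rw [Submodule.span_mul_span, Submodule.span_le]
    rintro _ ⟨_, ⟨p, rfl⟩, _, ⟨q, rfl⟩, rfl⟩
    simp only [pauliMonomial_mul]
    exact Submodule.smul_mem _ _ (Submodule.subset_span ⟨_, rfl⟩)
  exact hle (Submodule.mul_mem_mul hx hy)

theorem star_mem_span_pauliMonomial {x : Obs}
    (hx : x ∈ Submodule.span ℂ (Set.range pauliMonomial)) :
    star x ∈ Submodule.span ℂ (Set.range pauliMonomial) := by
  induction hx using Submodule.span_induction with
  | mem _ h =>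
    obtain ⟨p, rfl⟩ := h
    rw [star_pauliMonomial]
    exact Submodule.smul_mem _ _ (Submodule.subset_span ⟨p, rfl⟩)
  | zero => simp
  | add x y _ _ hx hy => rw [star_add]; exact add_mem hx hy
  | smul c x _ hx => rw [star_smul]; exact Submodule.smul_mem _ _ hx

/-- The dense `*`-subalgebra of linear combinations of Pauli monomials. -/
def pauliSpan : StarSubalgebra ℂ Obs where
  carrier := Submodule.span ℂ (Set.range pauliMonomial)
  mul_mem' := mul_mem_span_pauliMonomial
  add_mem' := add_mem (S := Submodule ℂ Obs)
  algebraMap_mem' c := by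
    rw [Algebra.algebraMap_eq_smul_one]
    exact Submodule.smul_mem _ _ (Submodule.subset_span ⟨fun _ => ∅, by simp [pauliMonomial]⟩)
  star_mem' := star_mem_span_pauliMonomial

theorem pauliMonomial_mem_pauliSpan (p : CSSType → Finset Vertex) :
    pauliMonomial p ∈ pauliSpan :=
  Submodule.subset_span ⟨p, rfl⟩

theorem site_mem_pauliSpan (v : Vertex) (M : Matrix (Fin 2) (Fin 2) ℂ) : site v M ∈ pauliSpan := by
  have hX : site v sigmaX ∈ pauliSpan := by
    simpa [pauliMonomial, pauliOp_singleton, CSSType.matrix] using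
      pauliMonomial_mem_pauliSpan fun | .x => {v} | .z => ∅
  have hZ : site v sigmaZ ∈ pauliSpan := by
    simpa [pauliMonomial, pauliOp_singleton, CSSType.matrix] using
      pauliMonomial_mem_pauliSpan fun | .x => ∅ | .z => {v}
  rw [matrix_eq_pauli_expansion M, site_add, site_add, site_add, site_smul, site_smul, site_smul,
    site_smul, site_one, site_mul]
  exact add_mem (add_mem (add_mem (pauliSpan.smul_mem (one_mem _) _) (pauliSpan.smul_mem hZ _))
    (pauliSpan.smul_mem hX _)) (pauliSpan.smul_mem (mul_mem hX hZ) _)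

theorem dense_pauliSpan : Dense (pauliSpan : Set Obs) :=
  Obs.mem_of_isClosed pauliSpan.topologicalClosure (StarSubalgebra.isClosed_topologicalClosure _)
    fun v M => StarSubalgebra.le_topologicalClosure _ (site_mem_pauliSpan v M)

theorem posFunctional_ext {ω ω' : PosFunctional}
    (h : ∀ p, ω (pauliMonomial p) = ω' (pauliMonomial p)) : ω = ω' := by
  have hspan : Set.EqOn ω ω' (pauliSpan : Set Obs) :=
    LinearMap.eqOn_span (f := ω.toLinearMap) (g := ω'.toLinearMap) (by rintro _ ⟨p, rfl⟩; exact h p)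
  exact DFunLike.coe_injective
    (Continuous.ext_on dense_pauliSpan (map_continuous ω) (map_continuous ω') hspan)

/-! ### Syndromes -/

/-- The six vertices of a face, as a finite set. -/
def Face.support (f : Face) : Finset Vertex := f.boundary.toFinset

theorem Face.mem_boundary {f : Face} {v : Vertex} : v ∈ f.boundary ↔ v ∈ f.support :=
  List.mem_toFinset.symm

theorem Face.mem_support {f : Face} {v : Vertex} : v ∈ f.support ↔
    f.1.1 ≤ v.1 ∧ v.1 ≤ f.1.1 + 2 ∧ f.1.2 ≤ v.2 ∧ v.2 ≤ f.1.2 + 1 := by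
  obtain ⟨x, y⟩ := v
  simp only [support, List.mem_toFinset, boundary, brick, List.map_cons, List.map_nil,
    List.mem_cons, List.not_mem_nil, or_false, Prod.ext_iff, Prod.fst_add, Prod.snd_add]
  omega

theorem Face.nodup_boundary (f : Face) : f.boundary.Nodup :=
  List.Nodup.map (add_right_injective _) (by decide)

theorem mem_facesMeeting_iff {Λ : Finset Vertex} {f : Face} :
    f ∈ facesMeeting Λ ↔ ∃ v ∈ f.support, v ∈ Λ := by
  simp [mem_facesMeeting, Face.support]

/-- The faces with an odd number of vertices in `a`: these are the excitations that a Pauli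
operator supported on `a` creates. -/
def syndrome (a : Finset Vertex) : Finset Face :=
  (facesMeeting a).filter fun f => interParity a f.support = 1

theorem interParity_syndrome (a : Finset Vertex) (f : Face) :
    interParity (syndrome a) {f} = interParity a f.support := by
  simp only [interParity_singleton_right, syndrome, Finset.mem_filter, mem_facesMeeting_iff]
  by_cases h : ∃ v ∈ f.support, v ∈ a
  · rcases eq_zero_or_eq_one (interParity a f.support) with h' | h' <;> simp [h, h']
  · have h' : interParity a f.support = 0 := by
      rw [interParity_eq_sum]
      exact Finset.sum_eq_zero fun v hv => if_neg fun hva => h ⟨v, hv, hva⟩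
    simp [h']

theorem syndrome_symmDiff (a b : Finset Vertex) : syndrome (a ∆ b) = syndrome a ∆ syndrome b :=
  eq_of_interParity_singleton_eq fun f => by
    simp only [interParity_symmDiff_left, interParity_syndrome]

@[simp] theorem syndrome_empty : syndrome ∅ = ∅ :=
  eq_of_interParity_singleton_eq fun f => by simp [interParity_syndrome]

theorem interParity_support (a : Finset Vertex) (f : Face) :
    interParity a f.support = (brick.map fun d => if f.1 + d ∈ a then 1 else 0).sum := by
  rw [interParity_eq_sum, Face.support, List.sum_toFinset _ f.nodup_boundary, Face.boundary,
    List.map_map]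
  rfl

/-- Two faces have `0`, `2` or `6` vertices in common. -/
theorem interParity_support_support (f g : Face) : interParity f.support g.support = 0 := by
  have hf := Int.odd_iff.1 f.2
  have hg := Int.odd_iff.1 g.2
  simp only [interParity_support, brick, List.map_cons, List.map_nil, List.sum_cons, List.sum_nil,
    Face.mem_support, Prod.fst_add, Prod.snd_add]
  split_ifs <;> first | rfl | (exfalso; omega)

@[simp] theorem syndrome_support (f : Face) : syndrome f.support = ∅ :=
  eq_of_interParity_singleton_eq fun g => by
    rw [interParity_syndrome, interParity_support_support, interParity_empty_left]

theorem interParity_support_of_syndrome_eq_empty {a : Finset Vertex} (ha : syndrome a = ∅)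
    (f : Face) : interParity a f.support = 0 := by
  rw [← interParity_syndrome, ha, interParity_empty_left]

theorem exists_ne_mem_support_of_syndrome_eq_empty {a : Finset Vertex} (ha : syndrome a = ∅)
    (f : Face) {v : Vertex} (hv : v ∈ a) (hf : v ∈ f.support) :
    ∃ w ∈ a, w ∈ f.support ∧ w ≠ v :=
  exists_ne_mem_of_interParity_eq_zero (interParity_support_of_syndrome_eq_empty ha f) hv hf

/-- The face whose upper right vertex is the topmost, then rightmost, vertex of a cycle does not
leave the quadrant containing the cycle. -/
theorem exists_support_of_syndrome_eq_empty {a : Finset Vertex} (ha : syndrome a = ∅)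
    {o v : Vertex} (ho : ∀ w ∈ a, o ≤ w) (hv : v ∈ a)
    (hmax : ∀ w ∈ a, w.2 < v.2 ∨ w.2 = v.2 ∧ w.1 ≤ v.1) :
    ∃ f : Face, v ∈ f.support ∧
      ∀ w ∈ f.support, o ≤ w ∧ (w ≠ v → w.2 < v.2 ∨ w.2 = v.2 ∧ w.1 < v.1) := by
  have hsecond (m n : ℤ) (hodd : Odd (m + n)) {v : Vertex} (hv : v ∈ a)
      (hf : v ∈ Face.support ⟨(m, n), hodd⟩) :
      ∃ w ∈ a, o ≤ w ∧ w ≠ v ∧ w ∈ Face.support ⟨(m, n), hodd⟩ := by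
    obtain ⟨w, hw, hwf, hne⟩ := exists_ne_mem_support_of_syndrome_eq_empty ha _ hv hf
    exact ⟨w, hw, ho w hw, hne, hwf⟩
  obtain ⟨x, y⟩ := v
  simp only [Face.mem_support, Prod.le_def, ne_eq, Prod.ext_iff, Int.odd_iff] at hsecond hmax ⊢
  have heven : (x + y) % 2 = 0 := by
    by_contra hodd
    obtain ⟨w, hw, _, hne, hwf⟩ := hsecond x y (by omega) hv (by omega)
    have := hmax w hw
    simp only at *
    omega
  have hleft : (x - 1, y) ∈ a := by
    obtain ⟨⟨x', y'⟩, hw, hwo, hne, hwf⟩ := hsecond (x - 1) y (by omega) hv (by omega)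
    have := hmax _ hw
    simp only at *
    obtain ⟨rfl, rfl⟩ : x' = x - 1 ∧ y' = y := by omega
    exact hw
  have hx : o.1 ≤ x - 2 := by
    obtain ⟨w, hw, hwo, hne, hwf⟩ := hsecond (x - 3) y (by omega) hleft (by omega)
    have := hmax _ hw
    simp only at *
    omega
  have hy : o.2 ≤ y - 1 := by
    obtain ⟨w, hw, hwo, hne, hwf⟩ := hsecond x (y - 1) (by omega) hv (by omega)
    have := hmax _ hw
    simp only at *
    omega
  refine ⟨⟨(x - 2, y - 1), by rw [Int.odd_iff]; simp only; omega⟩, by simp only; omega, ?_⟩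
  intro w hw
  simp only at *
  omega

/-- The position of a vertex of the quadrant above and to the right of `o` in the ordering by rows,
used to remove the faces of a cycle one at a time. -/
def lexRank (o v : Vertex) : ℕ ×ₗ ℕ := toLex ((v.2 - o.2).toNat, (v.1 - o.1).toNat)

theorem lexRank_lt_lexRank {o v w : Vertex} (hv : o ≤ v) (hw : o ≤ w) :
    lexRank o w < lexRank o v ↔ w.2 < v.2 ∨ w.2 = v.2 ∧ w.1 < v.1 := by
  simp only [Prod.le_def] at hv hw
  simp only [lexRank, Prod.Lex.toLex_lt_toLex]
  omega

theorem cycle_induction {p : Finset Vertex → Prop} (empty : p ∅)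
    (symmDiff_support : ∀ a f, p a → p (a ∆ Face.support f)) {a : Finset Vertex}
    (ha : syndrome a = ∅) : p a := by
  obtain ⟨o, ho⟩ : ∃ o, ∀ w ∈ a, o ≤ w := a.bddBelow
  obtain ⟨b, hrank⟩ : ∃ b, ∀ w ∈ a, lexRank o w < b := by
    obtain ⟨b, hb⟩ := (a.image (lexRank o)).bddAbove
    obtain ⟨b', hb'⟩ := exists_gt b
    exact ⟨b', fun w hw => (hb (Finset.mem_image_of_mem _ hw)).trans_lt hb'⟩
  induction b using WellFoundedLT.induction generalizing a with
  | ind b ih =>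
  rcases a.eq_empty_or_nonempty with rfl | hne
  · exact empty
  obtain ⟨v, hv, hmax⟩ := a.exists_max_image (lexRank o) hne
  have hmax' : ∀ w ∈ a, w.2 < v.2 ∨ w.2 = v.2 ∧ w.1 ≤ v.1 := fun w hw => by
    have := mt (lexRank_lt_lexRank (ho w hw) (ho v hv)).2 (hmax w hw).not_gt
    omega
  obtain ⟨f, hvf, hf⟩ := exists_support_of_syndrome_eq_empty ha ho hv hmax'
  have hmem {w : Vertex} (hw : w ∈ a ∆ f.support) : (w ∈ a ∨ w ∈ f.support) ∧ w ≠ v := by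
    rw [Finset.mem_symmDiff] at hw
    refine ⟨by tauto, ?_⟩
    rintro rfl
    tauto
  have ho' : ∀ w ∈ a ∆ f.support, o ≤ w := fun w hw =>
    (hmem hw).1.elim (ho w) fun h => (hf w h).1
  have hp := ih (lexRank o v) (hrank v hv) (a := a ∆ f.support)
    (by rw [syndrome_symmDiff, ha, syndrome_support, symmDiff_self, Finset.bot_eq_empty]) ho'
    fun w hw => (lexRank_lt_lexRank (ho v hv) (ho' w hw)).2 <| (hmem hw).1.elim
      (fun h => (hmax' w h).imp_right fun h' => ⟨h'.1, lt_of_le_of_ne h'.2 fun h'' =>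
        (hmem hw).2 (Prod.ext h'' h'.1)⟩)
      fun h => (hf w h).2 (hmem hw).2
  simpa [symmDiff_assoc, Finset.bot_eq_empty] using symmDiff_support _ f hp

/-! ### Colors and homology -/

theorem Face.color_eq_iff {f g : Face} : f.color = g.color ↔ f.1.1 % 3 = g.1.1 % 3 := by
  simp only [color]
  split_ifs <;> simp <;> omega

theorem lattice_adj_iff {v w : Vertex} : lattice.Adj v w ↔
    (w.2 = v.2 ∧ (w.1 = v.1 + 1 ∨ v.1 = w.1 + 1)) ∨
    (w.1 = v.1 ∧ ((w.2 = v.2 + 1 ∧ (v.1 + v.2) % 2 = 1) ∨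
      (v.2 = w.2 + 1 ∧ (v.1 + v.2) % 2 = 0))) := by
  obtain ⟨x, y⟩ := v
  obtain ⟨x', y'⟩ := w
  simp only [lattice, SimpleGraph.fromRel_adj, Prod.ext_iff, Int.odd_iff, ne_eq]
  omega

theorem Face.eq_of_mem_support {v : Vertex} {f g : Face} (hf : v ∈ f.support) (hg : v ∈ g.support)
    (hc : f.color = g.color) : f = g := by
  rw [color_eq_iff] at hc
  rw [mem_support] at hf hg
  have hf' := Int.odd_iff.1 f.2
  have hg' := Int.odd_iff.1 g.2
  refine Subtype.ext (Prod.ext ?_ ?_) <;> omega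

theorem mem_support_of_adj {u w : Vertex} {f f' g : Face} (hadj : lattice.Adj u w)
    (hu : u ∈ f.support) (hw : w ∈ f'.support) (hc : f.color = f'.color) (hne : f ≠ f')
    (hg : g.color ≠ f.color) (hug : u ∈ g.support) : w ∈ g.support := by
  have hwf : w ∉ f.support := fun h => hne (Face.eq_of_mem_support h hw hc)
  have huf : u ∉ f'.support := fun h => hne (Face.eq_of_mem_support hu h hc)
  rw [Ne, Face.color_eq_iff] at hg
  rw [Face.color_eq_iff] at hc
  rw [Face.mem_support] at *
  have hf := Int.odd_iff.1 f.2
  have hg' := Int.odd_iff.1 g.2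
  have hf' := Int.odd_iff.1 f'.2
  clear hne
  obtain ⟨x, y⟩ := u
  obtain ⟨x', y'⟩ := w
  rw [lattice_adj_iff] at hadj
  simp only at *
  rcases hadj with ⟨rfl, rfl | rfl⟩ | ⟨rfl, ⟨rfl, h⟩ | ⟨rfl, h⟩⟩ <;> omega

theorem syndrome_edge {u w : Vertex} {f f' : Face} (hadj : lattice.Adj u w) (hu : u ∈ f.support)
    (hw : w ∈ f'.support) (hc : f.color = f'.color) (hne : f ≠ f') :
    syndrome {u, w} = {f} ∆ {f'} := by
  have huw : ({u, w} : Finset Vertex) = {u} ∆ {w} := insert_eq_symmDiff (by simpa using hadj.ne)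
  refine eq_of_interParity_singleton_eq fun g => ?_
  simp only [interParity_syndrome, huw, interParity_symmDiff_left, interParity_singleton_left,
    Finset.mem_singleton]
  by_cases hg : g.color = f.color
  · have hug : u ∈ g.support ↔ f = g :=
      ⟨fun h => Face.eq_of_mem_support hu h hg.symm, by rintro rfl; exact hu⟩
    have hwg : w ∈ g.support ↔ f' = g :=
      ⟨fun h => Face.eq_of_mem_support hw h (hc.symm.trans hg.symm), by rintro rfl; exact hw⟩
    simp only [hug, hwg]
  · have huw' : u ∈ g.support ↔ w ∈ g.support :=
      ⟨mem_support_of_adj hadj hu hw hc hne hg,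
        mem_support_of_adj hadj.symm hw hu hc.symm hne.symm (hc ▸ hg)⟩
    have hf : f ≠ g := by rintro rfl; exact hg rfl
    have hf' : f' ≠ g := by rintro rfl; exact hg hc.symm
    simp only [huw', hf, hf', if_false, CharTwo.add_self_eq_zero]

/-- Two configurations of excitations that are connected by a Pauli operator of finite support. -/
def Homologous (e e' : Finset Face) : Prop := ∃ a, syndrome a = e ∆ e'

theorem Homologous.refl (e : Finset Face) : Homologous e e := ⟨∅, by simp⟩

theorem Homologous.symm {e e' : Finset Face} (h : Homologous e e') : Homologous e' e := by
  obtain ⟨a, ha⟩ := h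
  exact ⟨a, by rw [ha, symmDiff_comm]⟩

theorem Homologous.symmDiff {e₁ e₁' e₂ e₂' : Finset Face} (h₁ : Homologous e₁ e₁')
    (h₂ : Homologous e₂ e₂') : Homologous (e₁ ∆ e₂) (e₁' ∆ e₂') := by
  obtain ⟨a, ha⟩ := h₁
  obtain ⟨b, hb⟩ := h₂
  exact ⟨a ∆ b, by rw [syndrome_symmDiff, ha, hb, symmDiff_symmDiff_symmDiff_comm]⟩

theorem Homologous.trans {e₁ e₂ e₃ : Finset Face} (h₁ : Homologous e₁ e₂)
    (h₂ : Homologous e₂ e₃) : Homologous e₁ e₃ := by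
  obtain ⟨a, ha⟩ := h₁
  obtain ⟨b, hb⟩ := h₂
  exact ⟨a ∆ b, by rw [syndrome_symmDiff, ha, hb, symmDiff_assoc, symmDiff_symmDiff_cancel_left]⟩

theorem homologous_of_adj {u w : Vertex} {f f' : Face} (hadj : lattice.Adj u w)
    (hu : u ∈ f.support) (hw : w ∈ f'.support) (hc : f.color = f'.color) (hne : f ≠ f') :
    Homologous {f} {f'} :=
  ⟨{u, w}, syndrome_edge hadj hu hw hc hne⟩

theorem homologous_add_zero_two {f g : Face} (h : g.1 = f.1 + (0, 2)) : Homologous {f} {g} := by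
  have hf := Int.odd_iff.1 f.2
  obtain ⟨hx, hy⟩ : g.1.1 = f.1.1 ∧ g.1.2 = f.1.2 + 2 := by simp [h]
  refine homologous_of_adj (u := (f.1.1 + 1, f.1.2 + 1)) (w := (f.1.1 + 1, f.1.2 + 2))
    ?_ ?_ ?_ ?_ ?_
  · exact lattice_adj_iff.2 (.inr ⟨rfl, .inl ⟨by simp only; ring, by simp only; omega⟩⟩)
  · rw [Face.mem_support]; simp only; omega
  · rw [Face.mem_support]; simp only; omega
  · rw [Face.color_eq_iff, hx]
  · rintro rfl; omega

theorem homologous_add_three_one {f g : Face} (h : g.1 = f.1 + (3, 1)) : Homologous {f} {g} := by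
  obtain ⟨hx, hy⟩ : g.1.1 = f.1.1 + 3 ∧ g.1.2 = f.1.2 + 1 := by simp [h]
  refine homologous_of_adj (u := (f.1.1 + 2, f.1.2 + 1)) (w := (f.1.1 + 3, f.1.2 + 1))
    ?_ ?_ ?_ ?_ ?_
  · exact lattice_adj_iff.2 (.inl ⟨rfl, .inl (by simp only; ring)⟩)
  · rw [Face.mem_support]; simp only; omega
  · rw [Face.mem_support]; simp only; omega
  · rw [Face.color_eq_iff]; omega
  · rintro rfl; omega

/-- The translations of the lattice that move every single excitation to a homologous one. -/
def homologyPeriods : AddSubgroup (ℤ × ℤ) where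
  carrier := {t | Even (t.1 + t.2) ∧ ∀ f g : Face, g.1 = f.1 + t → Homologous {f} {g}}
  zero_mem' := ⟨⟨0, rfl⟩, fun f g h => by
    obtain rfl : g = f := Subtype.ext (by simpa using h)
    exact .refl _⟩
  add_mem' := by
    rintro s t ⟨hs, hs'⟩ ⟨ht, ht'⟩
    refine ⟨by simpa [add_add_add_comm] using hs.add ht, fun f g h => ?_⟩
    have hfs : Odd ((f.1 + s).1 + (f.1 + s).2) := by
      simpa [add_add_add_comm] using f.2.add_even hs
    exact (hs' f ⟨f.1 + s, hfs⟩ rfl).trans (ht' _ g (by rw [h, add_assoc]))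
  neg_mem' := by
    rintro t ⟨ht, ht'⟩
    refine ⟨by simpa [add_comm] using ht.neg, fun f g h => (ht' g f ?_).symm⟩
    rw [h, neg_add_cancel_right]

theorem homologous_of_color_eq {f g : Face} (h : f.color = g.color) : Homologous {f} {g} := by
  have h₀₂ : ((0, 2) : ℤ × ℤ) ∈ homologyPeriods := ⟨by decide, fun _ _ => homologous_add_zero_two⟩
  have h₃₁ : ((3, 1) : ℤ × ℤ) ∈ homologyPeriods := ⟨by decide, fun _ _ => homologous_add_three_one⟩
  obtain ⟨m, n, hmn⟩ : ∃ m n : ℤ, g.1 - f.1 = m • (3, 1) + n • (0, 2) := by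
    have hf := Int.odd_iff.1 f.2
    have hg := Int.odd_iff.1 g.2
    rw [Face.color_eq_iff] at h
    refine ⟨(g.1.1 - f.1.1) / 3, (g.1.2 - f.1.2 - (g.1.1 - f.1.1) / 3) / 2, Prod.ext ?_ ?_⟩ <;>
    · simp
      omega
  have hmem : g.1 - f.1 ∈ homologyPeriods :=
    hmn ▸ add_mem (zsmul_mem h₃₁ m) (zsmul_mem h₀₂ n)
  exact hmem.2 f g (by abel)

/-! ### Charges -/

instance : Nonempty Color := ⟨.r⟩

/-- The charge of a finite set of excitations that is detected by loops of color `c`: the parity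
of the number of excitations of the other two colors. -/
def charge (e : Finset Face) (c : Color) : ZMod 2 := ∑ f ∈ e, if f.color = c then 0 else 1

theorem charge_symmDiff (e e' : Finset Face) : charge (e ∆ e') = charge e + charge e' :=
  funext fun _ => sum_symmDiff _ _ _

@[simp] theorem charge_empty : charge ∅ = 0 := by
  ext
  simp [charge]

theorem charge_singleton (f : Face) (c : Color) : charge {f} c = if f.color = c then 0 else 1 := by
  simp [charge]

/-- For `i = 0, 1, 2`, the face around `v` whose lower left corner is `i` steps to the left. -/
def faceAt (v : Vertex) (i : ℤ) : Face :=
  ⟨(v.1 - i, v.2 - (v.1 - i + v.2 + 1) % 2), by rw [Int.odd_iff]; simp only; omega⟩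

theorem syndrome_singleton (v : Vertex) : syndrome {v} = {faceAt v 0, faceAt v 1, faceAt v 2} := by
  refine eq_of_interParity_singleton_eq fun f => ?_
  have hf := Int.odd_iff.1 f.2
  rw [interParity_syndrome, interParity_singleton_left, interParity_singleton_right]
  refine if_congr ?_ rfl rfl
  simp only [Face.mem_support, Finset.mem_insert, Finset.mem_singleton, faceAt, Subtype.ext_iff,
    Prod.ext_iff]
  omega

theorem charge_syndrome_singleton (v : Vertex) : charge (syndrome {v}) = 0 := by
  have hne {i j : ℤ} (h : i ≠ j) : faceAt v i ≠ faceAt v j := fun h' => by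
    have := congrArg (fun f : Face => f.1.1) h'
    simp only [faceAt] at this
    omega
  have hcolor (i j : ℤ) (h : (v.1 - i) % 3 = j) :
      (faceAt v i).color = if j = 0 then .r else if j = 1 then .g else .b := by
    rw [← h]; rfl
  ext c
  rw [syndrome_singleton, charge, Finset.sum_insert (by simp [hne]),
    Finset.sum_pair (hne (by decide))]
  obtain h | h | h : v.1 % 3 = 0 ∨ v.1 % 3 = 1 ∨ v.1 % 3 = 2 := by omega
  · rw [hcolor 0 0 (by omega), hcolor 1 2 (by omega), hcolor 2 1 (by omega)]
    cases c <;> rfl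
  · rw [hcolor 0 1 (by omega), hcolor 1 0 (by omega), hcolor 2 2 (by omega)]
    cases c <;> rfl
  · rw [hcolor 0 2 (by omega), hcolor 1 1 (by omega), hcolor 2 0 (by omega)]
    cases c <;> rfl

theorem charge_syndrome (a : Finset Vertex) : charge (syndrome a) = 0 := by
  induction a using Finset.induction_on with
  | empty => simp
  | insert v a hv ih =>
    rw [insert_eq_symmDiff hv, syndrome_symmDiff, charge_symmDiff, ih, charge_syndrome_singleton,
      add_zero]

theorem Homologous.charge_eq {e e' : Finset Face} (h : Homologous e e') : charge e = charge e' := by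
  obtain ⟨a, ha⟩ := h
  rw [← CharTwo.add_eq_zero, ← charge_symmDiff, ← ha, charge_syndrome]

theorem exists_subset_homologous (e : Finset Face) :
    ∃ t ⊆ syndrome {(0, 0)}, Homologous e t := by
  induction e using Finset.induction_on with
  | empty => exact ⟨∅, Finset.empty_subset _, .refl _⟩
  | insert f e hf ih =>
    obtain ⟨t, ht, het⟩ := ih
    obtain ⟨g, hg, hfg⟩ : ∃ g ∈ syndrome {(0, 0)}, f.color = g.color := by
      rw [syndrome_singleton]
      cases f.color
      exacts [⟨faceAt (0, 0) 0, by simp, rfl⟩, ⟨faceAt (0, 0) 2, by simp, rfl⟩,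
        ⟨faceAt (0, 0) 1, by simp, rfl⟩]
    refine ⟨{g} ∆ t, Finset.symmDiff_subset_union.trans (Finset.union_subset ?_ ht), ?_⟩
    · exact Finset.singleton_subset_iff.2 hg
    · rw [insert_eq_symmDiff hf]
      exact (homologous_of_color_eq hfg).symmDiff het

theorem homologous_empty_of_charge_eq_zero {e : Finset Face} (h : charge e = 0) :
    Homologous e ∅ := by
  obtain ⟨t, ht, het⟩ := exists_subset_homologous e
  have hdecide : ∀ t ∈ Finset.powerset {faceAt (0, 0) 0, faceAt (0, 0) 1, faceAt (0, 0) 2},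
      charge t .r = 0 ∧ charge t .g = 0 →
        t = ∅ ∨ t = {faceAt (0, 0) 0, faceAt (0, 0) 1, faceAt (0, 0) 2} := by
    decide
  rw [← syndrome_singleton] at hdecide
  have hcharge : charge t = 0 := het.charge_eq.symm.trans h
  obtain rfl | rfl :=
    hdecide t (Finset.mem_powerset.2 ht) ⟨congrFun hcharge _, congrFun hcharge _⟩
  · exact het
  · exact het.trans ⟨{(0, 0)}, by rw [← Finset.bot_eq_empty, symmDiff_bot]⟩

theorem homologous_of_charge_eq {e e' : Finset Face} (h : charge e = charge e') :
    Homologous e e' := by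
  obtain ⟨a, ha⟩ := homologous_empty_of_charge_eq_zero (e := e ∆ e')
    (by rw [charge_symmDiff, h, CharTwo.add_self_eq_zero])
  exact ⟨a, by rw [ha, ← Finset.bot_eq_empty, symmDiff_bot]⟩

/-! ### Positive functionals and GNS vectors -/

section PositiveFunctional

variable {A : Type*} [CStarAlgebra A] [PartialOrder A] [StarOrderedRing A]

/-- The vector `π(a) Ω` of the GNS space of `ω`, where `π` is the GNS representation and
`Ω = gnsVector ω 1` is its cyclic vector. -/
def gnsVector (ω : A →ₚ[ℂ] ℂ) : A →ₗ[ℂ] ω.GNS :=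
  (UniformSpace.Completion.toComplL (𝕜 := ℂ)).toLinearMap ∘ₗ ω.toPreGNS.toLinearMap

theorem gnsStarAlgHom_gnsVector (ω : A →ₚ[ℂ] ℂ) (a b : A) :
    ω.gnsStarAlgHom a (gnsVector ω b) = gnsVector ω (a * b) :=
  ω.gnsNonUnitalStarAlgHom_apply_coe

theorem inner_gnsVector (ω : A →ₚ[ℂ] ℂ) (a b : A) :
    inner ℂ (gnsVector ω a) (gnsVector ω b) = ω (star a * b) :=
  UniformSpace.Completion.inner_coe _ _

theorem norm_gnsVector_sq (ω : A →ₚ[ℂ] ℂ) (a : A) :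
    (‖gnsVector ω a‖ : ℂ) ^ 2 = ω (star a * a) := by
  rw [← inner_gnsVector, inner_self_eq_norm_sq_to_K]
  rfl

theorem denseRange_gnsVector (ω : A →ₚ[ℂ] ℂ) : DenseRange (gnsVector ω) :=
  UniformSpace.Completion.denseRange_coe.comp ω.toPreGNS.surjective.denseRange
    (UniformSpace.Completion.continuous_coe _)

theorem continuous_gnsVector (ω : A →ₚ[ℂ] ℂ) : Continuous (gnsVector ω) := by
  have hcyclic : ⇑(gnsVector ω) = fun a => ω.gnsStarAlgHom a (gnsVector ω 1) := by
    funext a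
    rw [gnsStarAlgHom_gnsVector, mul_one]
  rw [hcyclic]
  exact (map_continuous ω.gnsStarAlgHom).clm_apply continuous_const

theorem map_star_mul_self_nonneg (ω : A →ₚ[ℂ] ℂ) (a : A) : 0 ≤ ω (star a * a) :=
  ω.map_nonneg (star_mul_self_nonneg a)

theorem norm_gnsVector_of_mem_unitary {ω : A →ₚ[ℂ] ℂ} (hω : ω 1 = 1) {u : A}
    (hu : u ∈ unitary A) : ‖gnsVector ω u‖ = 1 := by
  have hsq := norm_gnsVector_sq ω u
  rw [Unitary.star_mul_self_of_mem hu, hω] at hsq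
  exact (pow_eq_one_iff_of_nonneg (norm_nonneg _) two_ne_zero).1 (by exact_mod_cast hsq)

theorem gnsVector_eq_smul_of_norm_map_eq_one {ω : A →ₚ[ℂ] ℂ} (hω : ω 1 = 1) {u : A}
    (hu : u ∈ unitary A) (hωu : ‖ω u‖ = 1) : gnsVector ω u = ω u • gnsVector ω 1 := by
  have hinner : inner ℂ (gnsVector ω 1) (gnsVector ω u) = ω u := by
    rw [inner_gnsVector, star_one, one_mul]
  have h1 := norm_gnsVector_of_mem_unitary hω (one_mem (unitary A))
  have hCS := (inner_eq_norm_mul_iff (𝕜 := ℂ) (x := ω u • gnsVector ω 1)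
    (y := gnsVector ω u)).1 (by
      rw [inner_smul_left, hinner, norm_smul, h1, norm_gnsVector_of_mem_unitary hω hu, hωu,
        RCLike.conj_mul, hωu]
      simp)
  simpa [norm_smul, h1, hωu, norm_gnsVector_of_mem_unitary hω hu] using hCS.symm

theorem map_mul_of_norm_map_eq_one {ω : A →ₚ[ℂ] ℂ} (hω : ω 1 = 1) {u : A}
    (hu : u ∈ unitary A) (hωu : ‖ω u‖ = 1) (a : A) : ω (a * u) = ω a * ω u := by
  rw [← star_star a, ← inner_gnsVector, gnsVector_eq_smul_of_norm_map_eq_one hω hu hωu,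
    inner_smul_right, inner_gnsVector, mul_one, mul_comm]

theorem map_mul_of_norm_map_eq_one' {ω : A →ₚ[ℂ] ℂ} (hω : ω 1 = 1) {u : A}
    (hu : u ∈ unitary A) (hωu : ‖ω u‖ = 1) (a : A) : ω (u * a) = ω u * ω a := by
  have h := map_mul_of_norm_map_eq_one hω (Unitary.star_mem hu)
    (by rw [map_star ω, norm_star, hωu]) (star a)
  rw [← star_mul, map_star ω, map_star ω, map_star ω, ← star_mul] at h
  exact star_injective h

theorem map_eq_zero_of_anticommute {ω : A →ₚ[ℂ] ℂ} (hω : ω 1 = 1) {u : A}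
    (hu : u ∈ unitary A) (hωu : ‖ω u‖ = 1) {a : A} (hua : u * a = -(a * u)) : ω a = 0 := by
  have h := map_mul_of_norm_map_eq_one' hω hu hωu a
  rw [hua, map_neg, map_mul_of_norm_map_eq_one hω hu hωu, mul_comm, neg_eq_self] at h
  exact (mul_eq_zero.1 h).resolve_left (norm_ne_zero_iff.1 (by simp [hωu]))

theorem exists_tendsto_posFunctional {ι : Type*} (U : Ultrafilter ι) (ω : ι → A →ₚ[ℂ] ℂ)
    (h : ∀ i a, ‖ω i a‖ ≤ ‖a‖) :
    ∃ φ : A →ₚ[ℂ] ℂ, ∀ a, Tendsto (fun i => ω i a) U (𝓝 (φ a)) := by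
  have hlim : ∀ a, ∃ z, Tendsto (fun i => ω i a) U (𝓝 z) := fun a => by
    obtain ⟨z, -, hz⟩ := (isCompact_closedBall (0 : ℂ) ‖a‖).ultrafilter_le_nhds'
      (U.map fun i => ω i a) (eventually_map.2 (.of_forall fun i => by simpa using h i a))
    exact ⟨z, hz⟩
  choose φ hφ using hlim
  refine ⟨.mk₀
    { toFun := φ
      map_add' := fun a b => tendsto_nhds_unique (hφ (a + b)) (by
        simpa only [map_add] using (hφ a).add (hφ b))
      map_smul' := fun c a => tendsto_nhds_unique (hφ (c • a)) (by
        simpa only [map_smul, RingHom.id_apply] using (hφ a).const_smul c) } fun a ha => ?_, hφ⟩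
  exact ge_of_tendsto (hφ a) (.of_forall fun i => (ω i).map_nonneg ha)

theorem tendsto_gnsStarAlgHom {ι : Type*} {l : Filter ι} {ω : A →ₚ[ℂ] ℂ} {L : ι → A}
    (hL : ∀ i, ‖L i‖ ≤ 1) {S : Set A} (hS : Dense S) (hc : ∀ a ∈ S, ∀ᶠ i in l, Commute (L i) a)
    {z : ℂ} (hz : ∀ᶠ i in l, gnsVector ω (L i) = z • gnsVector ω 1) (ξ : ω.GNS) :
    Tendsto (fun i => ω.gnsStarAlgHom (L i) ξ) l (𝓝 (z • ξ)) := by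
  have hlip : ∀ i, LipschitzWith 1 (ω.gnsStarAlgHom (L i)) := fun i =>
    LipschitzWith.of_dist_le_mul fun η ζ => by
      rw [dist_eq_norm, dist_eq_norm, ← map_sub]
      exact ContinuousLinearMap.le_of_opNorm_le _
        ((NonUnitalStarAlgHom.norm_apply_le ω.gnsStarAlgHom _).trans (hL i)) _
  have hclosed : IsClosed {η : ω.GNS | Tendsto (fun i => ω.gnsStarAlgHom (L i) η) l (𝓝 (z • η))} :=
    (LipschitzWith.uniformEquicontinuous _ 1 hlip).equicontinuous.isClosed_setOfPred_tendsto
      (continuous_const_smul z)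
  refine hclosed.closure_subset_iff.2 ?_ ((denseRange_gnsVector ω).dense_image
    (continuous_gnsVector ω) hS ξ)
  rintro _ ⟨a, ha, rfl⟩
  refine tendsto_const_nhds.congr' ?_
  filter_upwards [hc a ha, hz] with i hai hi
  rw [gnsStarAlgHom_gnsVector, hai.eq, ← gnsStarAlgHom_gnsVector, hi, map_smul,
    gnsStarAlgHom_gnsVector, mul_one]

end PositiveFunctional

/-! ### Equivalence of GNS representations -/

theorem equivOn_of_linearEquiv {B : StarSubalgebra ℂ Obs} {ω₁ ω₂ : PosFunctional}
    (e : Obs ≃ₗ[ℂ] Obs) (he : ∀ a, ω₂ (star (e a) * e a) = ω₁ (star a * a))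
    (hB : ∀ a ∈ B, ∀ b, e (a * b) = a * e b) : EquivOn B ω₁ ω₂ := by
  have hnorm : ∀ a, ‖gnsVector ω₂ (e a)‖ = ‖gnsVector ω₁ a‖ := fun a => by
    have hsq := (norm_gnsVector_sq ω₂ (e a)).trans ((he a).trans (norm_gnsVector_sq ω₁ a).symm)
    exact (pow_left_inj₀ (norm_nonneg _) (norm_nonneg _) two_ne_zero).1 (by exact_mod_cast hsq)
  have hU := e.extendOfIsometry_eq (gnsVector ω₁) (gnsVector ω₂) (denseRange_gnsVector ω₁)
    (denseRange_gnsVector ω₂) hnorm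
  refine ⟨e.extendOfIsometry (gnsVector ω₁) (gnsVector ω₂) (denseRange_gnsVector ω₁)
    (denseRange_gnsVector ω₂) hnorm, fun a ha => ?_⟩
  refine (denseRange_gnsVector ω₁).induction ?_ (isClosed_eq (by fun_prop) (by fun_prop))
  rintro _ ⟨b, rfl⟩
  rw [gnsStarAlgHom_gnsVector, hU, hU, gnsStarAlgHom_gnsVector, hB a ha]

theorem EquivOn.trans {B : StarSubalgebra ℂ Obs} {ω₁ ω₂ ω₃ : PosFunctional}
    (h : EquivOn B ω₁ ω₂) (h' : EquivOn B ω₂ ω₃) : EquivOn B ω₁ ω₃ := by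
  obtain ⟨U, hU⟩ := h
  obtain ⟨V, hV⟩ := h'
  refine ⟨U.trans V, fun a ha ξ => ?_⟩
  rw [LinearIsometryEquiv.trans_apply, LinearIsometryEquiv.trans_apply, hU a ha, hV a ha]

theorem EquivOn.mono {B B' : StarSubalgebra ℂ Obs} {ω₁ ω₂ : PosFunctional}
    (h : EquivOn B ω₁ ω₂) (hB : B' ≤ B) : EquivOn B' ω₁ ω₂ := by
  obtain ⟨U, hU⟩ := h
  exact ⟨U, fun a ha => hU a (hB ha)⟩

theorem equivOn_pullback {B : StarSubalgebra ℂ Obs} (ω : PosFunctional) {ρ : Obs →⋆ₐ[ℂ] Obs}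
    (hρ : Function.Bijective ρ) (hB : ∀ a ∈ B, ρ a = a) : EquivOn B (pullback ω ρ) ω :=
  equivOn_of_linearEquiv (LinearEquiv.ofBijective ρ.toAlgHom.toLinearMap hρ)
    (fun a => by
      change ω (star (ρ a) * ρ a) = ω (ρ (star a * a))
      rw [map_mul ρ, map_star ρ])
    (fun a ha b => by
      change ρ (a * b) = a * ρ b
      rw [map_mul, hB a ha])

theorem gnsEquiv_of_conj {ω ω' : PosFunctional} {u : Obs} (hu : u ∈ unitary Obs)
    (h : ∀ a, ω' a = ω (star u * a * u)) : GNSEquiv ω' ω := by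
  let e : Obs ≃ₗ[ℂ] Obs := .ofLinearMap (LinearMap.mulRight ℂ u) (LinearMap.mulRight ℂ (star u))
    (by ext; simp [mul_assoc, Unitary.star_mul_self_of_mem hu])
    (by ext; simp [mul_assoc, Unitary.mul_star_self_of_mem hu])
  have he : ∀ a, e a = a * u := fun _ => rfl
  refine equivOn_of_linearEquiv e (fun a => ?_) fun a _ b => ?_
  · simp only [he, star_mul, h, mul_assoc]
  · simp only [he, mul_assoc]

theorem GNSEquiv.eq_of_eventually_commute {ι : Type*} {l : Filter ι} [l.NeBot]
    {ω ω' : PosFunctional} (h : GNSEquiv ω ω') (hω : ω 1 = 1) (hω' : ω' 1 = 1) {L : ι → Obs}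
    (hL : ∀ i, L i ∈ unitary Obs) {S : Set Obs} (hS : Dense S)
    (hc : ∀ a ∈ S, ∀ᶠ i in l, Commute (L i) a) {z z' : ℂ} (hz : ‖z‖ = 1) (hz' : ‖z'‖ = 1)
    (hωL : ∀ᶠ i in l, ω (L i) = z) (hωL' : ∀ᶠ i in l, ω' (L i) = z') : z = z' := by
  obtain ⟨U, hU⟩ := h
  have : Nontrivial Obs := ⟨1, 0, fun h10 => by simp [h10] at hω⟩
  have hcyclic : ∀ {ω : PosFunctional} {z : ℂ}, ω 1 = 1 → ‖z‖ = 1 → (∀ᶠ i in l, ω (L i) = z) →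
      ∀ᶠ i in l, gnsVector ω (L i) = z • gnsVector ω 1 := fun hω hz hωL =>
    hωL.mono fun i hi => hi ▸ gnsVector_eq_smul_of_norm_map_eq_one hω (hL i) (hi ▸ hz)
  have hlim : Tendsto (fun i => ω'.gnsStarAlgHom (L i) (gnsVector ω' 1)) l
      (𝓝 (z • gnsVector ω' 1)) := by
    have hξ := tendsto_gnsStarAlgHom (fun i => (CStarRing.norm_of_mem_unitary (hL i)).le) hS hc
      (hcyclic hω hz hωL) (U.symm (gnsVector ω' 1))
    simpa only [Function.comp_def, hU _ trivial, map_smul, U.apply_symm_apply] using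
      (U.continuous.tendsto _).comp hξ
  have hconst : Tendsto (fun i => ω'.gnsStarAlgHom (L i) (gnsVector ω' 1)) l
      (𝓝 (z' • gnsVector ω' 1)) := tendsto_const_nhds.congr' <| by
    filter_upwards [hcyclic hω' hz' hωL'] with i hi
    rw [gnsStarAlgHom_gnsVector, mul_one, hi]
  refine smul_left_injective ℂ ?_ (tendsto_nhds_unique hlim hconst)
  exact norm_ne_zero_iff.1 (by simp [norm_gnsVector_of_mem_unitary hω' (one_mem _)])

/-! ### Check operators and excitations -/

/-- The symmetric difference of the supports of the faces in `G`: the `𝔽₂`-linear map from sets of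
faces to sets of vertices that is adjoint to `syndrome`. -/
def faceSum (G : Finset Face) : Finset Vertex := G.fold (· ∆ ·) ∅ Face.support

theorem faceSum_insert {f : Face} {G : Finset Face} (h : f ∉ G) :
    faceSum (insert f G) = f.support ∆ faceSum G :=
  Finset.fold_insert h

theorem interParity_faceSum (G : Finset Face) (a : Finset Vertex) :
    interParity (faceSum G) a = interParity (syndrome a) G := by
  induction G using Finset.induction_on with
  | empty => simp [faceSum]
  | insert f G hf ih =>
    rw [faceSum_insert hf, insert_eq_symmDiff hf, interParity_symmDiff_left,
      interParity_symmDiff_right, ih, interParity_syndrome, interParity_comm]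

theorem exists_faceSum_eq_of_syndrome_eq_empty {a : Finset Vertex} (ha : syndrome a = ∅) :
    ∃ G, faceSum G = a := by
  refine cycle_induction (p := fun a => ∃ G, faceSum G = a) ⟨∅, rfl⟩ ?_ ha
  rintro _ f ⟨G, rfl⟩
  refine ⟨G ∆ {f}, eq_of_interParity_singleton_eq fun v => ?_⟩
  rw [interParity_faceSum, interParity_symmDiff_right, interParity_symmDiff_left,
    interParity_faceSum, interParity_syndrome, interParity_comm f.support]

/-- The stabilizer at the face `f` that detects excitations created by operators of type `k`. -/
def check (k : CSSType) (f : Face) : Obs := pauliOp k.dual f.support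

@[simp] theorem star_check (k : CSSType) (f : Face) : star (check k f) = check k f :=
  star_pauliOp _ _

@[simp] theorem check_mul_self (k : CSSType) (f : Face) : check k f * check k f = 1 :=
  pauliOp_mul_self _ _

theorem check_mem_unitary (k : CSSType) (f : Face) : check k f ∈ unitary Obs :=
  pauliOp_mem_unitary _ _

theorem check_mul_pauliOp (k : CSSType) (f : Face) (a : Finset Vertex) :
    check k f * pauliOp k a =
      paritySign (interParity (syndrome a) {f}) • (pauliOp k a * check k f) := by
  have h := pauliOp_mul_pauliOp_dual k.dual f.support a
  rwa [CSSType.dual_dual, interParity_comm, ← interParity_syndrome] at h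

theorem check_dual_comm_pauliOp (k : CSSType) (f : Face) (a : Finset Vertex) :
    Commute (check k.dual f) (pauliOp k a) := by
  rw [check, CSSType.dual_dual]
  exact pauliOp_comm _ _ _

theorem check_comm (k k' : CSSType) (f g : Face) : Commute (check k f) (check k' g) := by
  have hdual (k : CSSType) : Commute (check k f) (check k.dual g) := by
    have h := pauliOp_mul_pauliOp_dual k.dual f.support g.support
    rwa [interParity_support_support, AddChar.map_zero_eq_one, one_smul] at h
  cases k <;> cases k'
  exacts [pauliOp_comm _ _ _, hdual .x, hdual .z, pauliOp_comm _ _ _]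

theorem check_mul_pauliMonomial (k : CSSType) (f : Face) (p : CSSType → Finset Vertex) :
    check k f * pauliMonomial p =
      paritySign (interParity (syndrome (p k)) {f}) • (pauliMonomial p * check k f) := by
  rw [check, pauliOp_dual_mul_pauliMonomial, interParity_syndrome]

@[simp] theorem norm_paritySign (z : ZMod 2) : ‖paritySign z‖ = 1 := by
  rcases eq_zero_or_eq_one z with rfl | rfl <;> simp

/-- `ω` is a state for which the set of excitations of type `k` is `e k`. -/
structure HasSyndrome (ω : PosFunctional) (e : CSSType → Finset Face) : Prop where
  map_one : ω 1 = 1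
  map_check : ∀ k f, ω (check k f) = paritySign (interParity (e k) {f})

namespace HasSyndrome

variable {ω ω' : PosFunctional} {e : CSSType → Finset Face}

theorem norm_map_check (h : HasSyndrome ω e) (k : CSSType) (f : Face) : ‖ω (check k f)‖ = 1 := by
  rw [h.map_check, norm_paritySign]

theorem map_check_mul (h : HasSyndrome ω e) (k : CSSType) (f : Face) (a : Obs) :
    ω (check k f * a) = paritySign (interParity (e k) {f}) * ω a := by
  rw [map_mul_of_norm_map_eq_one' h.map_one (check_mem_unitary k f) (h.norm_map_check k f),
    h.map_check]

theorem map_mul_check (h : HasSyndrome ω e) (k : CSSType) (f : Face) (a : Obs) :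
    ω (a * check k f) = paritySign (interParity (e k) {f}) * ω a := by
  rw [map_mul_of_norm_map_eq_one h.map_one (check_mem_unitary k f) (h.norm_map_check k f),
    h.map_check, mul_comm]

theorem map_pauliOp_faceSum (h : HasSyndrome ω e) (k : CSSType) (G : Finset Face) :
    ω (pauliOp k (faceSum G)) = paritySign (interParity (e k.dual) G) := by
  induction G using Finset.induction_on with
  | empty => simp [faceSum, h.map_one]
  | insert f G hf ih =>
    have hcheck : pauliOp k f.support = check k.dual f := by rw [check, CSSType.dual_dual]
    rw [faceSum_insert hf, ← pauliOp_mul, hcheck, h.map_check_mul, ih, insert_eq_symmDiff hf,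
      interParity_symmDiff_right, AddChar.map_add_eq_mul]

theorem map_pauliMonomial_faceSum (h : HasSyndrome ω e) (G : CSSType → Finset Face) :
    ω (pauliMonomial fun k => faceSum (G k)) =
      paritySign (interParity (e .z) (G .x)) * paritySign (interParity (e .x) (G .z)) := by
  have hx : ω (pauliOp .x (faceSum (G .x))) = paritySign (interParity (e .z) (G .x)) :=
    h.map_pauliOp_faceSum .x (G .x)
  have hz : ω (pauliOp .z (faceSum (G .z))) = paritySign (interParity (e .x) (G .z)) :=
    h.map_pauliOp_faceSum .z (G .z)
  rw [pauliMonomial, map_mul_of_norm_map_eq_one' h.map_one (pauliOp_mem_unitary _ _)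
    (by rw [hx, norm_paritySign]), hx, hz]

theorem map_pauliMonomial_eq_zero (h : HasSyndrome ω e) {p : CSSType → Finset Vertex}
    {k : CSSType} (hk : syndrome (p k) ≠ ∅) : ω (pauliMonomial p) = 0 := by
  obtain ⟨f, hf⟩ := Finset.nonempty_iff_ne_empty.2 hk
  refine map_eq_zero_of_anticommute h.map_one (check_mem_unitary k f) (h.norm_map_check k f) ?_
  rw [check_mul_pauliMonomial, interParity_singleton_right, if_pos hf, paritySign_one, neg_smul,
    one_smul]

theorem unique (h : HasSyndrome ω e) (h' : HasSyndrome ω' e) : ω = ω' := by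
  refine posFunctional_ext fun p => ?_
  by_cases hp : ∃ k, syndrome (p k) ≠ ∅
  · obtain ⟨k, hk⟩ := hp
    rw [h.map_pauliMonomial_eq_zero hk, h'.map_pauliMonomial_eq_zero hk]
  · push Not at hp
    choose G hG using fun k => exists_faceSum_eq_of_syndrome_eq_empty (hp k)
    obtain rfl : (fun k => faceSum (G k)) = p := funext hG
    rw [h.map_pauliMonomial_faceSum, h'.map_pauliMonomial_faceSum]

end HasSyndrome

/-! ### Existence of the ground state -/

/-- The functional `a ↦ ⟨ψ, a ψ⟩`. -/
def vectorState (ψ : ConfigSpace) : PosFunctional :=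
  PositiveLinearMap.mk₀
    { toFun := fun a => inner ℂ ψ (Obs.toOp a ψ)
      map_add' := fun a b => by simp
      map_smul' := fun c a => by simp } <| by
    intro a ha
    obtain ⟨b, rfl⟩ := CStarAlgebra.nonneg_iff_eq_star_mul_self.1 ha
    change 0 ≤ inner ℂ ψ (Obs.toOp (star b * b) ψ)
    rw [toOp_mul_apply, map_star, ContinuousLinearMap.star_eq_adjoint,
      ContinuousLinearMap.adjoint_inner_right, inner_self_eq_norm_sq_to_K, ← RCLike.ofReal_pow]
    exact RCLike.ofReal_nonneg.2 (sq_nonneg _)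

theorem vectorState_apply (ψ : ConfigSpace) (a : Obs) :
    vectorState ψ a = inner ℂ ψ (Obs.toOp a ψ) := rfl

theorem vectorState_apply_of_eq {ψ : ConfigSpace} (hψ : ‖ψ‖ = 1) {a : Obs}
    (ha : Obs.toOp a ψ = ψ) : vectorState ψ a = 1 := by
  rw [vectorState_apply, ha, inner_self_eq_norm_sq_to_K, hψ]
  simp

theorem norm_vectorState_le {ψ : ConfigSpace} (hψ : ‖ψ‖ = 1) (a : Obs) :
    ‖vectorState ψ a‖ ≤ ‖a‖ :=
  calc ‖vectorState ψ a‖ ≤ ‖ψ‖ * ‖Obs.toOp a ψ‖ := norm_inner_le_norm (𝕜 := ℂ) ψ _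
    _ ≤ ‖ψ‖ * (‖Obs.toOp a‖ * ‖ψ‖) := by gcongr; exact (Obs.toOp a).le_opNorm ψ
    _ = ‖a‖ := by rw [hψ, one_mul, mul_one]; rfl

theorem toOp_check_add_self (f : Face) (k : CSSType) (ψ : ConfigSpace) :
    Obs.toOp (check k f) (ψ + Obs.toOp (check k f) ψ) = ψ + Obs.toOp (check k f) ψ := by
  rw [map_add, ← toOp_mul_apply, check_mul_self, map_one, add_comm, one_apply_eq_self]

theorem toOp_check_add {k k' : CSSType} {f g : Face} {ψ : ConfigSpace}
    (h : Obs.toOp (check k f) ψ = ψ) :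
    Obs.toOp (check k f) (ψ + Obs.toOp (check k' g) ψ) = ψ + Obs.toOp (check k' g) ψ := by
  rw [map_add, ← toOp_mul_apply, (check_comm k k' f g).eq, toOp_mul_apply, h]

-- Symmetrizing the product state under the `K_f` keeps its coefficients nonnegative, and hence
-- nonzero.
theorem exists_stabilized_vector (F : Finset Face) : ∃ ψ : ConfigSpace,
    (∀ f ∈ F, Obs.toOp (check .z f) ψ = ψ) ∧ (∀ f, Obs.toOp (check .x f) ψ = ψ) ∧
      (∀ s, 0 ≤ ψ s) ∧ 1 ≤ ψ ∅ := by
  induction F using Finset.induction_on with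
  | empty =>
    have happ (s : Finset Vertex) :
        (lp.single 2 ∅ (1 : ℂ) : ConfigSpace) s = if s = ∅ then 1 else 0 := by
      rw [lp.single_apply, Pi.single_apply]
    refine ⟨lp.single 2 ∅ (1 : ℂ), by simp, fun f => ?_, fun s => ?_, ?_⟩
    · ext s
      rw [check, CSSType.dual, toOp_pauliOp_z, happ]
      split_ifs with hs <;> simp [hs]
    · rw [happ]
      split_ifs <;> simp
    · rw [happ, if_pos rfl]
  | insert f F hf ih =>
    obtain ⟨ψ, hK, hJ, hnonneg, hempty⟩ := ih
    have happ (s : Finset Vertex) :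
        (ψ + Obs.toOp (check .z f) ψ) s = ψ s + ψ (s ∆ f.support) := by
      rw [check, CSSType.dual, lp.coeFn_add, Pi.add_apply, toOp_pauliOp_x]
    refine ⟨ψ + Obs.toOp (check .z f) ψ, fun g hg => ?_, fun g => toOp_check_add (hJ g),
      fun s => ?_, ?_⟩
    · rcases Finset.mem_insert.1 hg with rfl | hg
      exacts [toOp_check_add_self _ _ _, toOp_check_add (hK g hg)]
    · rw [happ]
      exact add_nonneg (hnonneg _) (hnonneg _)
    · rw [happ]
      exact le_add_of_le_of_nonneg hempty (hnonneg _)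

theorem exists_stabilized_unit_vector (F : Finset Face) :
    ∃ ψ : ConfigSpace, ‖ψ‖ = 1 ∧ ∀ k, ∀ f ∈ F, Obs.toOp (check k f) ψ = ψ := by
  obtain ⟨ψ, hK, hJ, -, hempty⟩ := exists_stabilized_vector F
  have hne : ψ ≠ 0 := by
    rintro rfl
    exact absurd hempty (not_le_of_gt zero_lt_one)
  refine ⟨((‖ψ‖⁻¹ : ℝ) : ℂ) • ψ, ?_, fun k f hf => ?_⟩
  · simp [norm_smul, hne]
  · rw [map_smul]
    cases k
    exacts [congrArg _ (hJ f), congrArg _ (hK f hf)]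

theorem exists_hasSyndrome_empty : ∃ ω, HasSyndrome ω fun _ => ∅ := by
  choose ψ hψ hstab using exists_stabilized_unit_vector
  obtain ⟨φ, hφ⟩ := exists_tendsto_posFunctional (Ultrafilter.of (atTop : Filter (Finset Face)))
    (fun F => vectorState (ψ F)) (fun F => norm_vectorState_le (hψ F))
  have hlim {a : Obs} (ha : ∀ᶠ F in atTop, Obs.toOp a (ψ F) = ψ F) : φ a = 1 :=
    tendsto_nhds_unique (hφ a) (((tendsto_const_nhds (x := (1 : ℂ))).congr'
      (ha.mono fun F hF => (vectorState_apply_of_eq (hψ F) hF).symm)).mono_left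
        (Ultrafilter.of_le _))
  refine ⟨φ, hlim (.of_forall fun F => by rw [map_one]; rfl), fun k f => ?_⟩
  rw [interParity_empty_left, AddChar.map_zero_eq_one]
  exact hlim ((eventually_ge_atTop {f}).mono fun F hF => hstab F k f (by simpa using hF))

/-! ### Ground states -/

theorem hamiltonian_eq (Λ : Finset Vertex) (k : CSSType) :
    hamiltonian Λ = -∑ f ∈ facesMeeting Λ, (check k f + check k.dual f) := by
  have hK (f : Face) : stabK f = check .z f := siteProd_eq_pauliOp f.nodup_boundary .x
  have hJ (f : Face) : stabJ f = check .x f := siteProd_eq_pauliOp f.nodup_boundary .z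
  simp only [hamiltonian, hK, hJ, Finset.sum_add_distrib]
  cases k <;> simp only [CSSType.dual] <;> abel

theorem hamiltonian_comm_check (Λ : Finset Vertex) (k : CSSType) (f : Face) :
    Commute (hamiltonian Λ) (check k f) := by
  rw [hamiltonian_eq Λ k]
  exact (Commute.sum_left _ _ _ fun g _ =>
    (check_comm _ _ _ _).add_left (check_comm _ _ _ _)).neg_left

theorem check_commutator_pauliOp (k : CSSType) (f : Face) (a : Finset Vertex) :
    check k f * pauliOp k a - pauliOp k a * check k f =
      if f ∈ syndrome a then -((2 : ℂ) • (pauliOp k a * check k f)) else 0 := by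
  rw [check_mul_pauliOp, interParity_singleton_right]
  split_ifs
  · rw [paritySign_one, neg_smul, one_smul, two_smul, neg_add, sub_eq_add_neg]
  · rw [AddChar.map_zero_eq_one, one_smul, sub_self]

theorem syndrome_subset_facesMeeting {a Λ : Finset Vertex} (h : a ⊆ Λ) :
    syndrome a ⊆ facesMeeting Λ := fun f hf => by
  obtain ⟨v, hvf, hva⟩ := mem_facesMeeting_iff.1 (Finset.mem_of_mem_filter f hf)
  exact mem_facesMeeting_iff.2 ⟨v, hvf, h hva⟩

theorem hamiltonian_commutator_pauliOp (k : CSSType) {a Λ : Finset Vertex} (h : a ⊆ Λ) :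
    hamiltonian Λ * pauliOp k a - pauliOp k a * hamiltonian Λ =
      (2 : ℂ) • (pauliOp k a * ∑ f ∈ syndrome a, check k f) := by
  have hterm (f : Face) : pauliOp k a * (check k f + check k.dual f) -
      (check k f + check k.dual f) * pauliOp k a =
        if f ∈ syndrome a then (2 : ℂ) • (pauliOp k a * check k f) else 0 := by
    rw [mul_add, add_mul, (check_dual_comm_pauliOp k f a).eq, add_sub_add_right_eq_sub, ← neg_sub,
      check_commutator_pauliOp, neg_eq_iff_eq_neg]
    split_ifs <;> simp
  rw [hamiltonian_eq Λ k, neg_mul, mul_neg, Finset.mul_sum, Finset.sum_mul, sub_neg_eq_add,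
    neg_add_eq_sub, ← Finset.sum_sub_distrib, Finset.sum_congr rfl fun f _ => hterm f,
    ← Finset.sum_filter, Finset.filter_mem_eq_inter,
    Finset.inter_eq_right.2 (syndrome_subset_facesMeeting h), Finset.mul_sum, Finset.smul_sum]

/-- The projection onto the states with an excitation of type `k` at the face `f`. -/
def excitation (k : CSSType) (f : Face) : Obs := (2⁻¹ : ℂ) • (1 - check k f)

theorem check_eq_one_sub (k : CSSType) (f : Face) :
    check k f = 1 - (2 : ℂ) • excitation k f := by
  rw [excitation, smul_inv_smul₀ two_ne_zero, sub_sub_cancel]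

theorem isStarProjection_excitation (k : CSSType) (f : Face) :
    IsStarProjection (excitation k f) where
  isIdempotentElem := by
    have hsq : (1 - check k f) * (1 - check k f) = (2 : ℂ) • (1 - check k f) := by
      rw [mul_sub, sub_mul, sub_mul, check_mul_self, two_smul]
      simp only [one_mul, mul_one]
      abel
    rw [IsIdempotentElem, excitation, smul_mul_smul_comm, hsq, smul_smul]
    norm_num
  isSelfAdjoint := by
    simp [isSelfAdjoint_iff, excitation, star_smul]

theorem excitation_mem_localAlg (k : CSSType) {f : Face} {Λ : Set Vertex}
    (h : ↑f.support ⊆ Λ) : excitation k f ∈ localAlg Λ :=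
  SMulMemClass.smul_mem _ (sub_mem (one_mem _) (pauliOp_mem_localAlg _ h))

theorem check_le_one (k : CSSType) (f : Face) : check k f ≤ 1 := by
  rw [check_eq_one_sub, sub_le_self_iff, two_smul]
  exact add_nonneg (isStarProjection_excitation k f).nonneg (isStarProjection_excitation k f).nonneg

theorem HasSyndrome.neg_I_mul_map_derivation_nonneg {ω : PosFunctional}
    (h : HasSyndrome ω fun _ => ∅) (Λ : Finset Vertex) (A : Obs) :
    0 ≤ -Complex.I * ω (star A * derivation Λ A) := by
  have henergy : -Complex.I * ω (star A * derivation Λ A) =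
      ω (star A * hamiltonian Λ * A) - ω (star A * A * hamiltonian Λ) := by
    rw [derivation, mul_smul_comm, map_smul, smul_eq_mul, ← mul_assoc, neg_mul, Complex.I_mul_I,
      neg_neg, one_mul, mul_sub, map_sub, mul_assoc, mul_assoc (star A) A]
  have hground (k : CSSType) (f : Face) : ω (star A * A * check k f) = ω (star A * A) := by
    rw [h.map_mul_check, interParity_empty_left, AddChar.map_zero_eq_one, one_mul]
  have hcheck (k : CSSType) (f : Face) : ω (star A * check k f * A) ≤ ω (star A * A) := by
    simpa only [mul_one] using OrderHomClass.mono ω (star_left_conjugate_le_conjugate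
      (check_le_one k f) A)
  rw [henergy, hamiltonian_eq Λ .x]
  simp only [mul_neg, neg_mul, Finset.mul_sum, Finset.sum_mul, map_neg, map_sum, mul_add, add_mul,
    map_add, hground, sub_neg_eq_add]
  rw [neg_add_eq_sub, ← Finset.sum_sub_distrib]
  exact Finset.sum_nonneg fun f _ => sub_nonneg.2 (add_le_add (hcheck _ _) (hcheck _ _))

/-- The translate of the face `f` by a translation `t` of the lattice. -/
def Face.shift (f : Face) (t : ℤ × ℤ) (ht : Even (t.1 + t.2)) : Face :=
  ⟨f.1 + t, by
    have hodd := f.2.add_even ht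
    rwa [Prod.fst_add, Prod.snd_add, add_add_add_comm]⟩

theorem Face.support_shift (f : Face) (t : ℤ × ℤ) (ht : Even (t.1 + t.2)) :
    (f.shift t ht).support = f.support.image (· + t) := by
  ext v
  simp only [Finset.mem_image, Face.mem_support, Face.shift, Prod.fst_add, Prod.snd_add]
  constructor
  · intro h
    exact ⟨v - t, by simp only [Prod.fst_sub, Prod.snd_sub]; omega, sub_add_cancel v t⟩
  · rintro ⟨w, hw, rfl⟩
    simp only [Prod.fst_add, Prod.snd_add]
    omega

theorem translate_pauliOp (t : ℤ × ℤ) (k : CSSType) (a : Finset Vertex) :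
    translate t (pauliOp k a) = pauliOp k (a.image (· + t)) := by
  have h : translate t (pauliOp k a) = siteProd (a.toList.map (· + t)) k.matrix := by
    rw [pauliOp, siteProd, siteProd, map_list_prod, List.map_map, List.map_map]
    exact congrArg List.prod (List.map_congr_left fun v _ => translate_site _ _ _)
  rw [h, siteProd_eq_pauliOp (a.nodup_toList.map (add_left_injective t))]
  congr 1
  ext v
  simp only [List.mem_toFinset, List.mem_map, Finset.mem_toList, Finset.mem_image]

theorem translate_check {t : ℤ × ℤ} (ht : Even (t.1 + t.2)) (k : CSSType) (f : Face) :
    translate t (check k f) = check k (f.shift t ht) := by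
  rw [check, translate_pauliOp, ← Face.support_shift f t ht, check]

theorem HasSyndrome.isInvariantGroundState {ω : PosFunctional} (h : HasSyndrome ω fun _ => ∅) :
    IsInvariantGroundState ω where
  map_one := h.map_one
  ground Λ A _ := h.neg_I_mul_map_derivation_nonneg Λ A
  invariant t ht A := by
    have h' : HasSyndrome (pullback ω (translate t)) fun _ => ∅ :=
      ⟨by rw [pullback_apply, _root_.map_one, h.map_one], fun k f => by
        rw [pullback_apply, translate_check ht, h.map_check, interParity_empty_left,
          interParity_empty_left]⟩
    rw [← pullback_apply, h'.unique h]

theorem star_mul_derivation_pauliOp_mul_excitation (k : CSSType) {f f' : Face} (hne : f ≠ f')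
    {a Λ : Finset Vertex} (ha : syndrome a = {f, f'}) (hΛ : a ⊆ Λ) :
    star (pauliOp k a * excitation k f) * derivation Λ (pauliOp k a * excitation k f) =
      (-4 * Complex.I) • (excitation k f * excitation k f') := by
  have hE := isStarProjection_excitation k f
  have hH : hamiltonian Λ * excitation k f = excitation k f * hamiltonian Λ :=
    ((Commute.one_right _).sub_right (hamiltonian_comm_check Λ k f)).smul_right _
  have hE' : excitation k f' * excitation k f = excitation k f * excitation k f' :=
    (((Commute.one_left _).sub_left ((Commute.one_right _).sub_right
      (check_comm k k f' f))).smul_left _).smul_right _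
  have hcomm : hamiltonian Λ * (pauliOp k a * excitation k f) -
      pauliOp k a * excitation k f * hamiltonian Λ =
        (2 : ℂ) • (pauliOp k a * ((check k f + check k f') * excitation k f)) := by
    rw [← mul_assoc, mul_assoc (pauliOp k a), ← hH, ← mul_assoc, ← sub_mul,
      hamiltonian_commutator_pauliOp k hΛ, ha, Finset.sum_pair hne, smul_mul_assoc, mul_assoc]
  have hchecks : excitation k f * ((check k f + check k f') * excitation k f) =
      (-2 : ℂ) • (excitation k f * excitation k f') := by
    rw [add_mul, check_eq_one_sub, check_eq_one_sub k f', sub_mul, sub_mul, smul_mul_assoc,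
      smul_mul_assoc, hE.isIdempotentElem.eq, hE', one_mul, mul_add, mul_sub, mul_sub,
      mul_smul_comm, mul_smul_comm, ← mul_assoc, hE.isIdempotentElem.eq]
    module
  rw [derivation, hcomm, star_mul, star_pauliOp, hE.isSelfAdjoint.star_eq, mul_smul_comm,
    mul_smul_comm, mul_assoc, ← mul_assoc (pauliOp k a), pauliOp_mul_self, one_mul, hchecks,
    smul_smul, smul_smul]
  congr 1
  ring

theorem map_excitation_mul_excitation_nonpos {ω : PosFunctional}
    (hω : ∀ (Λ : Finset Vertex), ∀ A ∈ localAlg (Λ : Set Vertex),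
      0 ≤ -Complex.I * ω (star A * derivation Λ A)) (k : CSSType) {f f' : Face} (hne : f ≠ f')
    (hc : f.color = f'.color) : ω (excitation k f * excitation k f') ≤ 0 := by
  obtain ⟨a, ha⟩ := homologous_of_color_eq hc
  rw [← insert_eq_symmDiff (Finset.notMem_singleton.2 hne)] at ha
  have hmem : pauliOp k a * excitation k f ∈ localAlg (↑(a ∪ f.support) : Set Vertex) :=
    mul_mem (pauliOp_mem_localAlg k (by simp)) (excitation_mem_localAlg k (by simp))
  have h := hω (a ∪ f.support) _ hmem
  rw [star_mul_derivation_pauliOp_mul_excitation k hne ha Finset.subset_union_left, map_smul,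
    smul_eq_mul, ← mul_assoc] at h
  have hI : -Complex.I * (-4 * Complex.I) = -4 := by
    linear_combination (4 : ℂ) * Complex.I_mul_I
  rw [hI] at h
  have h4 := mul_nonneg (show (0 : ℂ) ≤ 4⁻¹ by simp) h
  rwa [neg_mul, mul_neg, inv_mul_cancel_left₀ four_ne_zero, neg_nonneg] at h4

theorem map_eq_zero_of_pairwise_nonpos {A : Type*} [CStarAlgebra A] [PartialOrder A]
    [StarOrderedRing A] {ω : A →ₚ[ℂ] ℂ} (hω : ω 1 = 1) {P : ℕ → A}
    (hP : ∀ n, IsStarProjection (P n)) {p : ℂ} (hp : ∀ n, ω (P n) = p)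
    (hPP : Pairwise fun m n => ω (P m * P n) ≤ 0) : p = 0 := by
  have hp0 : 0 ≤ p := (hp 0).symm ▸ ω.map_nonneg (hP 0).nonneg
  have hbound (N : ℕ) : N * p ≤ 1 := by
    set Y := ∑ n ∈ Finset.range N, P n with hY
    have hYstar : star Y = Y := by
      rw [hY, star_sum]
      exact Finset.sum_congr rfl fun n _ => (hP n).isSelfAdjoint.star_eq
    have hωY : ω Y = N * p := by
      rw [hY, map_sum, Finset.sum_congr rfl fun n _ => hp n, Finset.sum_const, Finset.card_range,
        nsmul_eq_mul]
    have hωYY : ω (Y * Y) ≤ N * p := by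
      rw [← hωY, hY, Finset.sum_mul_sum, map_sum, map_sum]
      refine Finset.sum_le_sum fun m hm => ?_
      rw [map_sum, ← Finset.add_sum_erase _ _ hm, (hP m).isIdempotentElem.eq]
      exact add_le_of_nonpos_right
        (Finset.sum_nonpos fun n hn => hPP (Finset.ne_of_mem_erase hn).symm)
    have hsq := map_star_mul_self_nonneg ω (1 - Y)
    rw [star_sub, star_one, hYstar, sub_mul, one_mul, mul_sub, mul_one, map_sub, map_sub, map_sub,
      hω, hωY] at hsq
    calc (N * p : ℂ) ≤ 1 - N * p - (N * p - ω (Y * Y)) + N * p := le_add_of_nonneg_left hsq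
      _ = 1 - N * p + ω (Y * Y) := by ring
      _ ≤ 1 - N * p + N * p := by gcongr
      _ = 1 := sub_add_cancel _ _
  lift p to ℝ using (Complex.nonneg_iff.1 hp0).2.symm
  norm_cast at hbound hp0 ⊢
  by_contra hne
  obtain ⟨N, hN⟩ := exists_lt_nsmul (lt_of_le_of_ne' hp0 hne) 1
  exact hN.not_ge (nsmul_eq_mul N p ▸ hbound N)

-- Translating `f` produces infinitely many faces of the same color, all excited with the same
-- probability, although no two of them are excited simultaneously.
theorem IsInvariantGroundState.hasSyndrome {ω : PosFunctional} (hω : IsInvariantGroundState ω) :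
    HasSyndrome ω fun _ => ∅ := by
  refine ⟨hω.map_one, fun k f => ?_⟩
  have ht (n : ℕ) : Even (((0, 2 * n) : ℤ × ℤ).1 + ((0, 2 * n) : ℤ × ℤ).2) := by simp
  let g (n : ℕ) : Face := f.shift (0, 2 * n) (ht n)
  have hg (n : ℕ) : ω (excitation k (g n)) = ω (excitation k f) := by
    rw [excitation, excitation, map_smul, map_smul, map_sub, map_sub, ← translate_check,
      hω.invariant _ (ht n)]
  have hcolor (m n : ℕ) : (g m).color = (g n).color := by
    simp [Face.color_eq_iff, g, Face.shift]
  have hinj {m n : ℕ} (hmn : m ≠ n) : g m ≠ g n := fun h => hmn <| by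
    simpa [g, Face.shift] using congrArg (fun f : Face => f.1.2) h
  have hzero := map_eq_zero_of_pairwise_nonpos hω.map_one
    (fun n => isStarProjection_excitation k (g n)) hg fun m n hmn =>
      map_excitation_mul_excitation_nonpos hω.ground k (hinj hmn) (hcolor m n)
  rw [check_eq_one_sub, map_sub, map_smul, hzero, smul_zero, sub_zero, hω.map_one,
    interParity_empty_left, AddChar.map_zero_eq_one]

/-! ### Equivalence of states with prescribed syndromes -/

theorem interParity_filter_color_ne {e G : Finset Face} (h : e ⊆ G) (c : Color) :
    interParity e (G.filter fun f => f.color ≠ c) = charge e c := by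
  rw [interParity_comm, interParity_eq_sum, charge]
  refine Finset.sum_congr rfl fun f hf => ?_
  by_cases hc : f.color = c <;> simp [hc, h hf]

theorem eventually_subset_facesMeeting (e : Finset Face) :
    ∀ᶠ Λ in (atTop : Filter (Finset Vertex)), e ⊆ facesMeeting Λ := by
  filter_upwards [eventually_ge_atTop (e.image Subtype.val)] with Λ hΛ f hf
  refine mem_facesMeeting_iff.2 ⟨f.1, ?_, hΛ (Finset.mem_image_of_mem _ hf)⟩
  rw [Face.mem_support]
  omega

/-- The operator measuring the charge of type `k` with respect to the color `c` in the region `Λ`: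
the product of the checks of type `k` at the faces of the other two colors that meet `Λ`. It acts
nontrivially only near the boundary of `Λ`. -/
def chargeOp (k : CSSType) (c : Color) (Λ : Finset Vertex) : Obs :=
  pauliOp k.dual (faceSum ((facesMeeting Λ).filter fun f => f.color ≠ c))

theorem HasSyndrome.eventually_map_chargeOp {ω : PosFunctional} {e : CSSType → Finset Face}
    (h : HasSyndrome ω e) (k : CSSType) (c : Color) :
    ∀ᶠ Λ in atTop, ω (chargeOp k c Λ) = paritySign (charge (e k) c) := by
  filter_upwards [eventually_subset_facesMeeting (e k)] with Λ hΛ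
  rw [chargeOp, h.map_pauliOp_faceSum, CSSType.dual_dual, interParity_filter_color_ne hΛ]

theorem eventually_commute_chargeOp (k : CSSType) (c : Color) {A : Obs} (hA : A ∈ pauliSpan) :
    ∀ᶠ Λ in atTop, Commute (chargeOp k c Λ) A := by
  induction hA using Submodule.span_induction with
  | mem A hA =>
    obtain ⟨p, rfl⟩ := hA
    filter_upwards [eventually_subset_facesMeeting (syndrome (p k))] with Λ hΛ
    rw [Commute, SemiconjBy, chargeOp, pauliOp_dual_mul_pauliMonomial, interParity_comm,
      interParity_faceSum, interParity_filter_color_ne hΛ, charge_syndrome, Pi.zero_apply,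
      AddChar.map_zero_eq_one, one_smul]
  | zero => exact .of_forall fun Λ => Commute.zero_right _
  | add A B _ _ hA hB => filter_upwards [hA, hB] with Λ using Commute.add_right
  | smul r A _ hA => filter_upwards [hA] with Λ h using h.smul_right r

theorem HasSyndrome.not_gnsEquiv {ω ω' : PosFunctional} {e e' : CSSType → Finset Face}
    (h : HasSyndrome ω e) (h' : HasSyndrome ω' e') {k : CSSType}
    (hne : charge (e k) ≠ charge (e' k)) : ¬GNSEquiv ω ω' := by
  intro hequiv
  obtain ⟨c, hc⟩ := Function.ne_iff.1 hne
  have hsign : paritySign (charge (e k) c) = paritySign (charge (e' k) c) :=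
    hequiv.eq_of_eventually_commute h.map_one h'.map_one
      (fun Λ => pauliOp_mem_unitary _ _) dense_pauliSpan
      (fun A hA => eventually_commute_chargeOp k c hA) (norm_paritySign _) (norm_paritySign _)
      (h.eventually_map_chargeOp k c) (h'.eventually_map_chargeOp k c)
  exact hc (paritySign_injective hsign)

/-- Conjugation `A ↦ U* A U` by the Pauli operator `U = pauliMonomial p`. -/
def pauliConj (p : CSSType → Finset Vertex) : Obs →⋆ₐ[ℂ] Obs :=
  (Unitary.conjStarAlgAut ℂ Obs (star ⟨pauliMonomial p, pauliMonomial_mem_unitary p⟩) :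
    Obs ≃⋆ₐ[ℂ] Obs)

theorem pauliConj_apply (p : CSSType → Finset Vertex) (A : Obs) :
    pauliConj p A = star (pauliMonomial p) * A * pauliMonomial p := by
  change _ * A * star (star (pauliMonomial p)) = _
  rw [star_star]
  rfl

/-- The endomorphism `ρ` creates the excitations `d k` of type `k`. -/
def HasFlux (ρ : Obs →⋆ₐ[ℂ] Obs) (d : CSSType → Finset Face) : Prop :=
  ∀ k f, ρ (check k f) = paritySign (interParity (d k) {f}) • check k f

theorem HasFlux.pullback {ρ : Obs →⋆ₐ[ℂ] Obs} {d e : CSSType → Finset Face} {ω : PosFunctional}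
    (hρ : HasFlux ρ d) (hω : HasSyndrome ω e) :
    HasSyndrome (pullback ω ρ) fun k => d k ∆ e k where
  map_one := by rw [pullback_apply, map_one, hω.map_one]
  map_check k f := by
    rw [pullback_apply, hρ, map_smul, hω.map_check, interParity_symmDiff_left,
      AddChar.map_add_eq_mul, smul_eq_mul]

theorem HasFlux.comp {ρ ρ' : Obs →⋆ₐ[ℂ] Obs} {d d' : CSSType → Finset Face}
    (hρ : HasFlux ρ d) (hρ' : HasFlux ρ' d') :
    HasFlux (ρ.comp ρ') fun k => d k ∆ d' k := by
  intro k f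
  rw [StarAlgHom.comp_apply, hρ', map_smul, hρ, smul_smul, interParity_symmDiff_left,
    AddChar.map_add_eq_mul, mul_comm]

theorem hasFlux_pauliConj (p : CSSType → Finset Vertex) :
    HasFlux (pauliConj p) fun k => syndrome (p k) := by
  intro k f
  rw [pauliConj_apply, mul_assoc, check_mul_pauliMonomial, mul_smul_comm, ← mul_assoc,
    (Unitary.mem_iff.1 (pauliMonomial_mem_unitary p)).1, one_mul]

theorem HasFlux.of_tendsto {ρ : Obs →⋆ₐ[ℂ] Obs} {d : CSSType → Finset Face}
    {p : ℕ → CSSType → Finset Vertex}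
    (hρ : ∀ A, Tendsto (fun n => pauliConj (p n) A) atTop (𝓝 (ρ A)))
    (hd : ∀ k f, ∀ᶠ n in atTop,
      interParity (syndrome (p n k)) {f} = interParity (d k) {f}) : HasFlux ρ d := by
  intro k f
  refine tendsto_nhds_unique (hρ (check k f)) (tendsto_const_nhds.congr' ?_)
  filter_upwards [hd k f] with n hn
  rw [hasFlux_pauliConj, hn]

theorem HasSyndrome.gnsEquiv {ω ω' : PosFunctional} {e e' : CSSType → Finset Face}
    (h : HasSyndrome ω e) (h' : HasSyndrome ω' e') (hc : ∀ k, charge (e k) = charge (e' k)) :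
    GNSEquiv ω ω' := by
  choose p hp using fun k => homologous_of_charge_eq (hc k)
  have hpull : HasSyndrome (ColorCode.pullback ω' (pauliConj p)) e := by
    convert (hasFlux_pauliConj p).pullback h' using 2 with k
    rw [hp, symmDiff_symmDiff_cancel_right]
  refine gnsEquiv_of_conj (pauliMonomial_mem_unitary p) fun A => ?_
  rw [h.unique hpull, pullback_apply, pauliConj_apply]

/-! ### Half-infinite strings -/

/-- Whether `σ^p` has a factor `σ^k`, where `σ^y` stands for `σ^x σ^z`. -/
def Pauli.contains : Pauli → CSSType → Bool
  | .x, .x | .y, _ | .z, .z => true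
  | _, _ => false

theorem stringOp_eq_pauliMonomial {l : List Vertex} (hl : l.Nodup) (p : Pauli) :
    stringOp l p = pauliMonomial fun k => if p.contains k then l.toFinset else ∅ := by
  have hx : siteProd l sigmaX = pauliOp .x l.toFinset := siteProd_eq_pauliOp hl .x
  have hz : siteProd l sigmaZ = pauliOp .z l.toFinset := siteProd_eq_pauliOp hl .z
  cases p <;> simp [stringOp, pauliMonomial, Pauli.contains, hx, hz, pauliOp_empty]

theorem stringConj_eq_pauliConj {l : List Vertex} (hl : l.Nodup) (p : Pauli) :
    stringConj l p = pauliConj fun k => if p.contains k then l.toFinset else ∅ := by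
  ext A
  rw [stringConj_apply, pauliConj_apply, stringOp_eq_pauliMonomial hl]

namespace HalfString

variable {c : Color} (γ : HalfString c)

theorem vertices_succ (n : ℕ) : γ.vertices (n + 1) = γ.vertices n ++ [γ.src n, γ.tgt n] := by
  simp [vertices, List.range_succ]

theorem mem_vertices {n : ℕ} {v : Vertex} :
    v ∈ γ.vertices n ↔ ∃ i < n, v = γ.src i ∨ v = γ.tgt i := by
  simp [vertices]

theorem src_notMem_vertices (n : ℕ) : γ.src n ∉ γ.vertices n := by
  rw [mem_vertices]
  rintro ⟨i, hi, h | h⟩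
  · exact hi.ne' (γ.src_injective h)
  · exact γ.src_ne_tgt _ _ h

theorem tgt_notMem_vertices (n : ℕ) : γ.tgt n ∉ γ.vertices n := by
  rw [mem_vertices]
  rintro ⟨i, hi, h | h⟩
  · exact γ.src_ne_tgt _ _ h.symm
  · exact hi.ne' (γ.tgt_injective h)

theorem nodup_vertices (n : ℕ) : (γ.vertices n).Nodup := by
  induction n with
  | zero => simp [vertices]
  | succ n ih =>
    simp only [γ.vertices_succ, List.nodup_append, List.nodup_cons, List.mem_cons,
      List.not_mem_nil, or_false, forall_eq_or_imp, forall_eq]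
    exact ⟨ih, by simpa using γ.src_ne_tgt n n, fun v hv =>
      ⟨fun h => γ.src_notMem_vertices n (h ▸ hv), fun h => γ.tgt_notMem_vertices n (h ▸ hv)⟩⟩

theorem toFinset_vertices_succ (n : ℕ) :
    (γ.vertices (n + 1)).toFinset = (γ.vertices n).toFinset ∆ {γ.src n, γ.tgt n} := by
  have hdisj : Disjoint (γ.vertices n).toFinset ({γ.src n, γ.tgt n} : Finset Vertex) := by
    simp [γ.src_notMem_vertices, γ.tgt_notMem_vertices]
  rw [hdisj.symmDiff_eq_sup, γ.vertices_succ, List.toFinset_append]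
  simp

theorem syndrome_vertices (n : ℕ) :
    syndrome (γ.vertices n).toFinset = {γ.face 0} ∆ {γ.face n} := by
  induction n with
  | zero => simp [vertices]
  | succ n ih =>
    rw [toFinset_vertices_succ, syndrome_symmDiff, ih, syndrome_edge (γ.adj n)
      (Face.mem_boundary.1 (γ.src_mem n)) (Face.mem_boundary.1 (γ.tgt_mem n))
      ((γ.color_face n).trans (γ.color_face _).symm) (γ.face_ne n), symmDiff_assoc,
      symmDiff_symmDiff_cancel_left]

theorem eventually_face_ne (f : Face) : ∀ᶠ n in atTop, γ.face n ≠ f := by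
  have h : ∀ᶠ n in atTop, γ.src n ∉ f.support := by
    rw [← Nat.cofinite_eq_atTop]
    exact γ.src_injective.tendsto_cofinite.eventually f.support.finite_toSet.compl_mem_cofinite
  filter_upwards [h] with n hn hf
  exact hn (Face.mem_boundary.1 (hf ▸ γ.src_mem n))

theorem hasFlux_rho (p : Pauli) :
    HasFlux (γ.rho p) fun k => if p.contains k then {γ.face 0} else ∅ := by
  refine .of_tendsto (p := fun n k => if p.contains k then (γ.vertices n).toFinset else ∅)
    (fun A => ?_) fun k f => ?_
  · simp only [← stringConj_eq_pauliConj (γ.nodup_vertices _)]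
    exact γ.tendsto_rhoFun p A
  · filter_upwards [γ.eventually_face_ne f] with n hn
    split_ifs
    · simp [syndrome_vertices, interParity_symmDiff_left, interParity_singleton_left, hn]
    · rw [syndrome_empty]

end HalfString

/-! ### Limits of Pauli automorphisms -/

theorem exists_tendsto_starAlgHom (φ : ℕ → Obs →⋆ₐ[ℂ] Obs)
    (h : ∀ v M, ∃ b, Tendsto (fun n => φ n (site v M)) atTop (𝓝 b)) :
    ∃ ρ : Obs →⋆ₐ[ℂ] Obs, ∀ A, Tendsto (fun n => φ n A) atTop (𝓝 (ρ A)) := by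
  choose ρ hρ using exists_lim_of_site φ h
  exact ⟨{
    toFun := ρ
    map_one' := tendsto_nhds_unique (hρ 1) (by simpa only [map_one] using tendsto_const_nhds)
    map_mul' := fun a b => tendsto_nhds_unique (hρ (a * b)) (by
      simpa only [map_mul] using (hρ a).mul (hρ b))
    map_zero' := tendsto_nhds_unique (hρ 0) (by simpa only [map_zero] using tendsto_const_nhds)
    map_add' := fun a b => tendsto_nhds_unique (hρ (a + b)) (by
      simpa only [map_add] using (hρ a).add (hρ b))
    commutes' := fun r => tendsto_nhds_unique (hρ (algebraMap ℂ Obs r)) (by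
      simpa only [AlgHomClass.commutes] using tendsto_const_nhds)
    map_star' := fun a => tendsto_nhds_unique (hρ (star a)) (by
      simpa only [map_star] using (hρ a).star) }, hρ⟩

theorem involutive_of_tendsto {A : Type*} [CStarAlgebra A] {φ : ℕ → A →⋆ₐ[ℂ] A}
    {ρ : A →⋆ₐ[ℂ] A} (hρ : ∀ a, Tendsto (fun n => φ n a) atTop (𝓝 (ρ a)))
    (hφ : ∀ n, Function.Involutive (φ n)) : Function.Involutive ρ := by
  intro a
  refine tendsto_nhds_unique (hρ (ρ a)) (tendsto_iff_norm_sub_tendsto_zero.2 ?_)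
  refine squeeze_zero (fun n => norm_nonneg _) (fun n => ?_)
    (tendsto_iff_norm_sub_tendsto_zero.1 (hρ a))
  calc ‖φ n (ρ a) - a‖ = ‖φ n (ρ a - φ n a)‖ := by rw [map_sub, hφ]
    _ ≤ ‖ρ a - φ n a‖ := NonUnitalStarAlgHom.norm_apply_le (φ n) _
    _ = _ := norm_sub_rev _ _

theorem starAlgHom_eq_self_of_site {ρ : Obs →⋆ₐ[ℂ] Obs} {Λ : Set Vertex}
    (h : ∀ v ∈ Λ, ∀ M, ρ (site v M) = site v M) {A : Obs} (hA : A ∈ localAlg Λ) : ρ A = A := by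
  suffices localAlg Λ ≤ StarAlgHom.equalizer ρ (StarAlgHom.id ℂ Obs) from this hA
  refine StarSubalgebra.topologicalClosure_minimal (StarAlgebra.adjoin_le ?_)
    (isClosed_eq (map_continuous ρ) continuous_id)
  rintro _ ⟨v, hv, M, rfl⟩
  exact h v hv M

theorem pauliConj_symmDiff (p q : CSSType → Finset Vertex) (A : Obs) :
    pauliConj (fun k => p k ∆ q k) A = pauliConj q (pauliConj p A) := by
  set σ := paritySign (interParity (p .z) (q .x))
  have hσ : star σ * σ = 1 := by
    rw [RCLike.star_def, RCLike.conj_mul, norm_paritySign]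
    norm_num
  calc pauliConj (fun k => p k ∆ q k) A
      = (star σ * σ) • pauliConj (fun k => p k ∆ q k) A := by rw [hσ, one_smul]
    _ = star (σ • pauliMonomial fun k => p k ∆ q k) * A * σ • pauliMonomial fun k => p k ∆ q k := by
        simp only [pauliConj_apply, star_smul, smul_mul_assoc, mul_smul_comm, smul_smul, mul_comm]
    _ = pauliConj q (pauliConj p A) := by
        rw [← pauliMonomial_mul]
        simp only [pauliConj_apply, star_mul, mul_assoc]

theorem pauliConj_involutive (p : CSSType → Finset Vertex) :
    Function.Involutive (pauliConj p) := by
  intro A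
  rw [← pauliConj_symmDiff, pauliConj_apply]
  simp [pauliMonomial, pauliOp_empty]

theorem pauliConj_site_of_notMem {p : CSSType → Finset Vertex} {v : Vertex} (h : ∀ k, v ∉ p k)
    (M : Matrix (Fin 2) (Fin 2) ℂ) : pauliConj p (site v M) = site v M := by
  have hcomm : Commute (pauliMonomial p) (site v M) :=
    (pauliOp_comm_site .x (h .x) M).mul_left (pauliOp_comm_site .z (h .z) M)
  rw [pauliConj_apply, mul_assoc, ← hcomm.eq, ← mul_assoc,
    (Unitary.mem_iff.1 (pauliMonomial_mem_unitary p)).1, one_mul]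

theorem pauliConj_site (p : CSSType → Finset Vertex) (v : Vertex)
    (M : Matrix (Fin 2) (Fin 2) ℂ) :
    pauliConj p (site v M) = pauliConj (fun k => p k ∩ {v}) (site v M) := by
  have hp : p = fun k => (p k \ {v}) ∆ (p k ∩ {v}) := by
    ext k w
    simp only [Finset.mem_symmDiff, Finset.mem_sdiff, Finset.mem_inter]
    tauto
  conv_lhs => rw [hp]
  rw [pauliConj_symmDiff, pauliConj_site_of_notMem (by simp)]

/-- The excitations `d` can be created by chains in `W` that stabilize locally while their
remaining excitations escape to infinity. -/
def Creatable (W : Set Vertex) (d : Finset Face) : Prop :=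
  ∃ a : ℕ → Finset Vertex, (∀ n, ↑(a n) ⊆ W) ∧ (∀ v, ∃ s, ∀ᶠ n in atTop, a n ∩ {v} = s) ∧
    ∀ f, ∀ᶠ n in atTop, interParity (syndrome (a n)) {f} = interParity d {f}

theorem Creatable.empty (W : Set Vertex) : Creatable W ∅ :=
  ⟨fun _ => ∅, by simp, fun _ => ⟨∅, by simp⟩, by simp⟩

theorem Creatable.symmDiff {W : Set Vertex} {d d' : Finset Face} (h : Creatable W d)
    (h' : Creatable W d') : Creatable W (d ∆ d') := by
  obtain ⟨a, haW, ha, had⟩ := h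
  obtain ⟨b, hbW, hb, hbd⟩ := h'
  refine ⟨fun n => a n ∆ b n, fun n v hv => ?_, fun v => ?_, fun f => ?_⟩
  · rcases Finset.mem_symmDiff.1 hv with ⟨hv, -⟩ | ⟨hv, -⟩
    exacts [haW n hv, hbW n hv]
  · obtain ⟨s, hs⟩ := ha v
    obtain ⟨t, ht⟩ := hb v
    refine ⟨s ∆ t, ?_⟩
    filter_upwards [hs, ht] with n hs ht
    rw [← hs, ← ht]
    exact inf_symmDiff_distrib_right _ _ _
  · filter_upwards [had f, hbd f] with n ha hb
    rw [syndrome_symmDiff, interParity_symmDiff_left, interParity_symmDiff_left, ha, hb]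

theorem exists_hasFlux_of_creatable {W : Set Vertex} {d : CSSType → Finset Face}
    (h : ∀ k, Creatable W (d k)) :
    ∃ ρ : Obs →⋆ₐ[ℂ] Obs, HasFlux ρ d ∧ Function.Bijective ρ ∧ ∀ A ∈ localAlg Wᶜ, ρ A = A := by
  choose a haW ha had using h
  obtain ⟨ρ, hρ⟩ := exists_tendsto_starAlgHom (fun n => pauliConj fun k => a k n) fun v M => by
    choose s hs using fun k => ha k v
    refine ⟨pauliConj s (site v M), tendsto_const_nhds.congr' ?_⟩
    filter_upwards [hs .x, hs .z] with n hx hz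
    have hsn : (fun k => a k n ∩ {v}) = s := funext fun k => by cases k <;> assumption
    rw [pauliConj_site fun k => a k n, hsn]
  refine ⟨ρ, .of_tendsto hρ had,
    (involutive_of_tendsto hρ fun n => pauliConj_involutive _).bijective,
    fun A => starAlgHom_eq_self_of_site fun v hv M => ?_⟩
  refine tendsto_nhds_unique (hρ _) (tendsto_const_nhds.congr fun n => ?_)
  rw [pauliConj_site_of_notMem fun k h => hv (haW k n h)]

theorem exists_creatable_of_path {W : Set Vertex} {F : ℕ → Face} {s : ℕ → Finset Vertex}
    (hs : ∀ n, syndrome (s n) = {F n} ∆ {F (n + 1)}) (hsW : ∀ᶠ n in atTop, ↑(s n) ⊆ W)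
    (hv : ∀ v, ∀ᶠ n in atTop, v ∉ s n) (hF : ∀ f, ∀ᶠ n in atTop, F n ≠ f) :
    ∃ N, Creatable W {F N} := by
  obtain ⟨N, hN⟩ := eventually_atTop.1 hsW
  let b : ℕ → Finset Vertex := Nat.rec ∅ fun n x => x ∆ s (N + n)
  have hb (n : ℕ) : b (n + 1) = b n ∆ s (N + n) := rfl
  have hsyn (n : ℕ) : syndrome (b n) = {F N} ∆ {F (N + n)} := by
    induction n with
    | zero => simp [b]
    | succ n ih => rw [hb, syndrome_symmDiff, ih, hs, symmDiff_assoc,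
        symmDiff_symmDiff_cancel_left, add_assoc]
  have htail {P : ℕ → Prop} (h : ∀ᶠ n in atTop, P n) : ∀ᶠ n in atTop, P (N + n) :=
    (tendsto_add_atTop_nat N).eventually h |>.mono fun n h => add_comm n N ▸ h
  refine ⟨N, b, fun n => ?_, fun v => ?_, fun f => ?_⟩
  · induction n with
    | zero => simp [b]
    | succ n ih =>
      intro v hv
      rcases Finset.mem_symmDiff.1 (hb n ▸ hv) with ⟨hv, -⟩ | ⟨hv, -⟩
      exacts [ih hv, hN _ (Nat.le_add_right N n) hv]
  · obtain ⟨m, hm⟩ := eventually_atTop.1 (htail (hv v))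
    refine ⟨b m ∩ {v}, eventually_atTop.2 ⟨m, fun n hn => ?_⟩⟩
    induction n, hn using Nat.le_induction with
    | base => rfl
    | succ n hn ih =>
      rw [← ih, hb]
      ext w
      simp only [Finset.mem_inter, Finset.mem_symmDiff, Finset.mem_singleton]
      have := hm n hn
      constructor <;> rintro ⟨h, rfl⟩ <;> tauto
  · filter_upwards [htail (hF f)] with n hn
    simp [hsyn, interParity_symmDiff_left, interParity_singleton_left, hn]

/-! ### Cones -/

theorem position_add_nsmul (v t : Vertex) (n : ℕ) :
    position (v + n • t) = position v + (n : ℝ) • position t := by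
  ext i
  fin_cases i <;> simp [position]

/-- The open convex cone of directions of `cone p a θ`, which consists of the vertices `v` for
which `position v - p` is in this set. -/
def coneDirections (a : EuclideanSpace ℝ (Fin 2)) (θ : ℝ) : Set (EuclideanSpace ℝ (Fin 2)) :=
  {x | ‖x‖ * Real.cos θ < inner ℝ x a}

theorem isOpen_coneDirections (a : EuclideanSpace ℝ (Fin 2)) (θ : ℝ) :
    IsOpen (coneDirections a θ) :=
  isOpen_lt (by fun_prop) (by fun_prop)

theorem smul_mem_coneDirections {a x : EuclideanSpace ℝ (Fin 2)} {θ r : ℝ} (hr : 0 < r)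
    (hx : x ∈ coneDirections a θ) : r • x ∈ coneDirections a θ := by
  rw [coneDirections, Set.mem_ofPred_eq, norm_smul, Real.norm_of_nonneg hr.le,
    real_inner_smul_left, mul_assoc]
  exact mul_lt_mul_of_pos_left hx hr

theorem self_mem_coneDirections {a : EuclideanSpace ℝ (Fin 2)} {θ : ℝ} (ha : ‖a‖ = 1)
    (h0 : 0 < θ) (hπ : θ < Real.pi) : a ∈ coneDirections a θ := by
  have hcos : Real.cos θ < 1 := by
    rw [← Real.cos_zero]
    exact Real.cos_lt_cos_of_nonneg_of_le_pi le_rfl hπ.le h0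
  rw [coneDirections, Set.mem_ofPred_eq, real_inner_self_eq_norm_sq, ha]
  simpa using hcos

theorem zero_notMem_coneDirections (a : EuclideanSpace ℝ (Fin 2)) (θ : ℝ) :
    0 ∉ coneDirections a θ := by
  simp [coneDirections]

theorem eventually_add_nsmul_mem_cone {a : EuclideanSpace ℝ (Fin 2)} {θ : ℝ} {t : Vertex}
    (ht : position t ∈ coneDirections a θ) (p : EuclideanSpace ℝ (Fin 2)) (v : Vertex) :
    ∀ᶠ n : ℕ in atTop, v + n • t ∈ cone p a θ := by
  have hlim : Tendsto (fun n : ℕ => (n : ℝ)⁻¹ • (position v - p) + position t) atTop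
      (𝓝 (position t)) := by
    have := (tendsto_inv_atTop_nhds_zero_nat (𝕜 := ℝ)).smul_const (position v - p)
    simpa using this.add_const (position t)
  filter_upwards [hlim.eventually ((isOpen_coneDirections a θ).mem_nhds ht),
    eventually_gt_atTop 0] with n hn hn0
  have hpos : (0 : ℝ) < n := by exact_mod_cast hn0
  have hscale : position (v + n • t) - p =
      (n : ℝ) • ((n : ℝ)⁻¹ • (position v - p) + position t) := by
    rw [smul_add, smul_smul, mul_inv_cancel₀ hpos.ne', one_smul, position_add_nsmul]
    abel
  change position (v + n • t) - p ∈ coneDirections a θ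
  exact hscale ▸ smul_mem_coneDirections hpos hn

theorem exists_position_nsmul_mem {U : Set (EuclideanSpace ℝ (Fin 2))} (hU : IsOpen U)
    (hne : U.Nonempty) (hscale : ∀ r : ℝ, 0 < r → ∀ x ∈ U, r • x ∈ U) {m : ℕ} (hm : 0 < m) :
    ∃ t : Vertex, position (m • t) ∈ U := by
  let emb : ℝ × ℝ → EuclideanSpace ℝ (Fin 2) := fun x => !₂[x.1, x.2]
  have hemb : Continuous emb := by
    refine (PiLp.continuous_toLp 2 _).comp (continuous_pi fun i => ?_)
    fin_cases i
    exacts [continuous_fst, continuous_snd]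
  obtain ⟨a, ha⟩ := hne
  have ha' : emb (a 0, a 1) ∈ U := by
    convert ha
    ext i
    fin_cases i <;> rfl
  obtain ⟨⟨q, r⟩, hqr⟩ := (Rat.denseRange_cast (𝕜 := ℝ)).prodMap (Rat.denseRange_cast (𝕜 := ℝ))
    |>.exists_mem_open (hU.preimage hemb) ⟨_, ha'⟩
  refine ⟨(q.num * r.den, r.num * q.den), ?_⟩
  have hclear : position (m • (q.num * r.den, r.num * q.den)) =
      (m * q.den * r.den : ℝ) • emb ((q : ℝ), (r : ℝ)) := by
    have hq : (q : ℝ) * q.den = q.num := by exact_mod_cast Rat.mul_den_eq_num q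
    have hr : (r : ℝ) * r.den = r.num := by exact_mod_cast Rat.mul_den_eq_num r
    ext i
    fin_cases i
    · simp [position, emb, ← hq]; ring
    · simp [position, emb, ← hr]; ring
  have hpos : (0 : ℝ) < m * q.den * r.den := by
    have := q.pos
    have := r.pos
    positivity
  exact hclear ▸ hscale _ hpos _ hqr

theorem syndrome_image_add {P : Finset Vertex} {f g : Face} (hP : syndrome P = {f} ∆ {g})
    (t : ℤ × ℤ) (ht : Even (t.1 + t.2)) :
    syndrome (P.image (· + t)) = {f.shift t ht} ∆ {g.shift t ht} := by
  refine eq_of_interParity_singleton_eq fun h => ?_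
  have ht' : Even ((-t).1 + (-t).2) := by
    rw [Prod.fst_neg, Prod.snd_neg, ← neg_add]
    exact ht.neg
  have hshift : h = (h.shift (-t) ht').shift t ht := Subtype.ext (by simp [Face.shift])
  have hmem (f : Face) : h.shift (-t) ht' = f ↔ h = f.shift t ht := by
    rw [Subtype.ext_iff, Subtype.ext_iff]
    exact add_neg_eq_iff_eq_add
  rw [interParity_syndrome, hshift, Face.support_shift, interParity_image (add_left_injective t),
    ← interParity_syndrome, hP, ← hshift, interParity_symmDiff_left, interParity_symmDiff_left]
  simp only [interParity_singleton_right, Finset.mem_singleton, hmem]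

theorem eventually_notMem_image_add_nsmul {t : Vertex} (ht : t ≠ 0) (P : Finset Vertex)
    (v : Vertex) : ∀ᶠ n : ℕ in atTop, v ∉ P.image (· + n • t) := by
  have hinj : Function.Injective fun n : ℕ => n • t := by
    intro m n h
    exact_mod_cast smul_left_injective ℤ ht
      (show (m : ℤ) • t = (n : ℤ) • t by simpa only [natCast_zsmul] using h)
  have hfin : ∀ᶠ n : ℕ in atTop, n • t ∉ P.image (v - ·) := by
    rw [← Nat.cofinite_eq_atTop]
    exact hinj.tendsto_cofinite.eventually (P.image (v - ·)).finite_toSet.compl_mem_cofinite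
  filter_upwards [hfin] with n hn hv
  obtain ⟨w, hw, rfl⟩ := Finset.mem_image.1 hv
  exact hn (Finset.mem_image.2 ⟨w, hw, by simp⟩)

theorem exists_creatable_of_period {W : Set Vertex} {t : Vertex}
    (hW : ∀ v : Vertex, ∀ᶠ n : ℕ in atTop, v + n • t ∈ W) (ht : t ≠ 0) (heven : Even (t.1 + t.2))
    (hthree : 3 ∣ t.1) (c : Color) : ∃ f : Face, f.color = c ∧ Creatable W {f} := by
  obtain ⟨f, hf⟩ : ∃ f : Face, f.color = c := by
    cases c
    exacts [⟨⟨(0, 1), by decide⟩, by decide⟩, ⟨⟨(1, 0), by decide⟩, by decide⟩,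
      ⟨⟨(2, 1), by decide⟩, by decide⟩]
  have hevenn (n : ℕ) : Even ((n • t).1 + (n • t).2) := by
    rw [Prod.smul_fst, Prod.smul_snd, ← smul_add, nsmul_eq_mul]
    exact heven.mul_left _
  let F (n : ℕ) : Face := f.shift (n • t) (hevenn n)
  have hFc (n : ℕ) : (F n).color = c := by
    rw [← hf, Face.color_eq_iff]
    change (f.1.1 + n • t.1) % 3 = f.1.1 % 3
    rw [nsmul_eq_mul]
    exact Int.emod_eq_emod_iff_emod_sub_eq_zero.2 (by
      rw [add_sub_cancel_left]; exact Int.emod_eq_zero_of_dvd (hthree.mul_left _))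
  obtain ⟨P, hP⟩ := homologous_of_color_eq ((hFc 0).trans (hFc 1).symm)
  suffices ∃ N, Creatable W {F N} from this.elim fun N hN => ⟨F N, hFc N, hN⟩
  refine exists_creatable_of_path (s := fun n => P.image (· + n • t)) (fun n => ?_) ?_
    (fun v => eventually_notMem_image_add_nsmul ht P v) fun g => ?_
  · rw [syndrome_image_add hP _ (hevenn n)]
    congr 2 <;> refine Subtype.ext ?_ <;> simp only [Face.shift, F] <;> module
  · filter_upwards [(P.eventually_all (l := atTop)).2 fun v _ => hW v] with n hn v hv
    obtain ⟨w, hw, rfl⟩ := Finset.mem_image.1 (Finset.mem_coe.1 hv)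
    exact hn w hw
  · filter_upwards [eventually_notMem_image_add_nsmul ht {f.1} g.1] with n hn hg
    exact hn (by simp [← hg, F, Face.shift])

theorem exists_creatable_cone_of_color {a : EuclideanSpace ℝ (Fin 2)} {θ : ℝ} (ha : ‖a‖ = 1)
    (h0 : 0 < θ) (hπ : θ < Real.pi) (p : EuclideanSpace ℝ (Fin 2)) (c : Color) :
    ∃ f : Face, f.color = c ∧ Creatable (cone p a θ) {f} := by
  obtain ⟨t, ht⟩ := exists_position_nsmul_mem (isOpen_coneDirections a θ)
    ⟨a, self_mem_coneDirections ha h0 hπ⟩ (fun _ hr _ => smul_mem_coneDirections hr)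
    (show 0 < 6 by norm_num)
  refine exists_creatable_of_period (eventually_add_nsmul_mem_cone ht p) ?_ ?_ ?_ c
  · intro hzero
    refine zero_notMem_coneDirections a θ ?_
    convert ht
    rw [hzero]
    ext i
    fin_cases i <;> simp [position]
  · rw [Prod.smul_fst, Prod.smul_snd, ← smul_add]
    exact ⟨3 • (t.1 + t.2), by module⟩
  · exact ⟨2 * t.1, by rw [Prod.smul_fst, nsmul_eq_mul]; push_cast; ring⟩

theorem exists_creatable_cone {a : EuclideanSpace ℝ (Fin 2)} {θ : ℝ} (ha : ‖a‖ = 1)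
    (h0 : 0 < θ) (hπ : θ < Real.pi) (p : EuclideanSpace ℝ (Fin 2)) (e : Finset Face) :
    ∃ d, charge d = charge e ∧ Creatable (cone p a θ) d := by
  induction e using Finset.induction_on with
  | empty => exact ⟨∅, rfl, .empty _⟩
  | insert f e hf ih =>
    obtain ⟨d, hd, hdW⟩ := ih
    obtain ⟨g, hg, hgW⟩ := exists_creatable_cone_of_color ha h0 hπ p f.color
    refine ⟨{g} ∆ d, ?_, hgW.symmDiff hdW⟩
    rw [insert_eq_symmDiff hf, charge_symmDiff, charge_symmDiff, hd]
    congr 1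
    ext c
    rw [charge_singleton, charge_singleton, hg]

theorem HasSyndrome.isSuperselectionSector {ω₀ ω : PosFunctional} {e : CSSType → Finset Face}
    (h₀ : HasSyndrome ω₀ fun _ => ∅) (h : HasSyndrome ω e) : IsSuperselectionSector ω₀ ω := by
  intro p a θ ha h0 hπ
  choose d hdc hd using fun k => exists_creatable_cone ha h0 hπ p (e k)
  obtain ⟨ρ, hρ, hbij, hloc⟩ := exists_hasFlux_of_creatable hd
  have hequiv : GNSEquiv ω (ColorCode.pullback ω₀ ρ) :=
    h.gnsEquiv (hρ.pullback h₀) fun k => by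
      rw [charge_symmDiff, hdc, charge_empty, add_zero]
  exact (hequiv.mono le_top).trans (equivOn_pullback ω₀ hbij hloc)

/-! ### Charges of the strings -/

instance : Fintype Color := ⟨{.r, .g, .b}, fun c => by cases c <;> decide⟩

instance : Fintype Pauli := ⟨{.x, .y, .z}, fun p => by cases p <;> decide⟩

instance : Fintype CSSType := ⟨{.x, .z}, fun k => by cases k <;> decide⟩

/-- The charge of the excitation at the end of a string of color `c` and Pauli label `p`. -/
def endCharge (c : Color) (p : Pauli) (k : CSSType) (c' : Color) : ZMod 2 :=
  if p.contains k ∧ c ≠ c' then 1 else 0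

theorem charge_end {c : Color} (γ : HalfString c) (p : Pauli) (k : CSSType) :
    charge (if p.contains k then {γ.face 0} else ∅) = endCharge c p k := by
  ext c'
  by_cases h : p.contains k = true
  · rw [if_pos h, charge_singleton, γ.color_face]
    by_cases hc : c = c' <;> simp [endCharge, h, hc]
  · simp [h, endCharge]

theorem exists_hasSyndrome_stringState {ω₀ : PosFunctional} (h₀ : HasSyndrome ω₀ fun _ => ∅)
    (s : StringType) (γ : HalfString s.color) : ∃ e, HasSyndrome (stringState ω₀ s γ) e ∧
      ∀ k, charge (e k) = endCharge s.color s.pauli k :=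
  ⟨_, (γ.hasFlux_rho s.pauli).pullback h₀, fun k => by
    rw [charge_symmDiff, charge_end, charge_empty, add_zero]⟩

theorem exists_hasSyndrome_compositeState {ω₀ : PosFunctional} (h₀ : HasSyndrome ω₀ fun _ => ∅)
    (s t : StringType) (γ : HalfString s.color) (γ' : HalfString t.color) :
    ∃ e, HasSyndrome (compositeState ω₀ s t γ γ') e ∧
      ∀ k, charge (e k) = endCharge s.color s.pauli k + endCharge t.color t.pauli k :=
  ⟨_, ((γ.hasFlux_rho s.pauli).comp (γ'.hasFlux_rho t.pauli)).pullback h₀, fun k => by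
    rw [charge_symmDiff, charge_symmDiff, charge_end, charge_end, charge_empty, add_zero]⟩

theorem exists_endCharge_add_ne_zero {c c' : Color} {p p' : Pauli} (hc : c ≠ c') (hp : p ≠ p') :
    ∃ k, endCharge c p k + endCharge c' p' k ≠ 0 := by
  revert c c' p p'
  decide

theorem exists_endCharge_add_ne {c c' : Color} {p p' : Pauli} (hc : c ≠ c') (hp : p ≠ p')
    (c'' : Color) (p'' : Pauli) :
    ∃ k, endCharge c p k + endCharge c' p' k ≠ endCharge c'' p'' k := by
  revert c c' p p' c'' p''
  decide

/-- The charge of the `i`-th fermion, computed from the `j`-th pair of strings. -/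
def fermionCharge (i : Fin 6) (j : Fin 3) (k : CSSType) : Color → ZMod 2 :=
  endCharge (fermionPairs i j).1.color (fermionPairs i j).1.pauli k +
    endCharge (fermionPairs i j).2.color (fermionPairs i j).2.pauli k

theorem fermionCharge_eq (i : Fin 6) (j j' : Fin 3) (k : CSSType) :
    fermionCharge i j k = fermionCharge i j' k := by
  revert i j j' k
  decide

theorem exists_fermionCharge_ne {i i' : Fin 6} (h : i ≠ i') (j j' : Fin 3) :
    ∃ k, fermionCharge i j k ≠ fermionCharge i' j' k := by
  revert i i' j j'
  decide

end ColorCode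

end

theorem mainTheorem5 :
    ∃ ω₀ : PosFunctional,
      -- `ω₀` is the unique translation invariant ground state
      (IsInvariantGroundState ω₀ ∧ ∀ ω : PosFunctional, IsInvariantGroundState ω → ω = ω₀) ∧
      -- every composite is a superselection sector, inequivalent to `π₀` and to all `π^{ck}`
      (∀ s t : StringType, s.color ≠ t.color → s.pauli ≠ t.pauli →
        ∀ (γ : HalfString s.color) (γ' : HalfString t.color),
          IsSuperselectionSector ω₀ (compositeState ω₀ s t γ γ') ∧
          ¬ GNSEquiv (compositeState ω₀ s t γ γ') ω₀ ∧
          ∀ (u : StringType) (γ'' : HalfString u.color),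
            ¬ GNSEquiv (compositeState ω₀ s t γ γ') (stringState ω₀ u γ'')) ∧
      -- the three pairs of strings listed for a fermion give equivalent representations
      (∀ (i : Fin 6) (j j' : Fin 3)
        (γ₁ : HalfString (fermionPairs i j).1.color) (γ₂ : HalfString (fermionPairs i j).2.color)
        (δ₁ : HalfString (fermionPairs i j').1.color)
        (δ₂ : HalfString (fermionPairs i j').2.color),
          GNSEquiv
            (compositeState ω₀ (fermionPairs i j).1 (fermionPairs i j).2 γ₁ γ₂)
            (compositeState ω₀ (fermionPairs i j').1 (fermionPairs i j').2 δ₁ δ₂)) ∧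
      -- different fermions are inequivalent
      (∀ (i i' : Fin 6), i ≠ i' → ∀ (j j' : Fin 3)
        (γ₁ : HalfString (fermionPairs i j).1.color) (γ₂ : HalfString (fermionPairs i j).2.color)
        (δ₁ : HalfString (fermionPairs i' j').1.color)
        (δ₂ : HalfString (fermionPairs i' j').2.color),
          ¬ GNSEquiv
            (compositeState ω₀ (fermionPairs i j).1 (fermionPairs i j).2 γ₁ γ₂)
            (compositeState ω₀ (fermionPairs i' j').1 (fermionPairs i' j').2 δ₁ δ₂)) := by
  obtain ⟨ω₀, h₀⟩ := exists_hasSyndrome_empty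
  refine ⟨ω₀, ⟨h₀.isInvariantGroundState, fun ω hω => hω.hasSyndrome.unique h₀⟩, ?_, ?_, ?_⟩
  · intro s t hc hp γ γ'
    obtain ⟨e, he, hq⟩ := exists_hasSyndrome_compositeState h₀ s t γ γ'
    refine ⟨h₀.isSuperselectionSector he, ?_, fun u γ'' => ?_⟩
    · obtain ⟨k, hk⟩ := exists_endCharge_add_ne_zero hc hp
      exact he.not_gnsEquiv h₀ (k := k) (by rwa [hq, charge_empty])
    · obtain ⟨e', he', hq'⟩ := exists_hasSyndrome_stringState h₀ u γ''
      obtain ⟨k, hk⟩ := exists_endCharge_add_ne hc hp u.color u.pauli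
      exact he.not_gnsEquiv he' (k := k) (by rwa [hq, hq'])
  · intro i j j' γ₁ γ₂ δ₁ δ₂
    obtain ⟨e, he, hq⟩ := exists_hasSyndrome_compositeState h₀ _ _ γ₁ γ₂
    obtain ⟨e', he', hq'⟩ := exists_hasSyndrome_compositeState h₀ _ _ δ₁ δ₂
    exact he.gnsEquiv he' fun k => by rw [hq, hq']; exact fermionCharge_eq i j j' k
  · intro i i' hii j j' γ₁ γ₂ δ₁ δ₂
    obtain ⟨e, he, hq⟩ := exists_hasSyndrome_compositeState h₀ _ _ γ₁ γ₂
    obtain ⟨e', he', hq'⟩ := exists_hasSyndrome_compositeState h₀ _ _ δ₁ δ₂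
    obtain ⟨k, hk⟩ := exists_fermionCharge_ne hii j j'
    exact he.not_gnsEquiv he' (k := k) (by rwa [hq, hq'])
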